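/- **Theorem (convergence rate of one-sided Shampoo).** Let $d_L,d_R,T\ge 1$ and $d=d_Ld_R$, identify $\mathbb R^d$ with $\mathbb R^{d_L\times d_R}$ (Frobenius inner product; $x=\mathrm{vec}(X)$ with coordinates ordered so that $(A\otimes I_{d_R})\,\mathrm{vec}(X)=\mathrm{vec}(AX)$), and let $\mathcal X\subseteq\mathbb R^{d_L\times d_R}$ be convex and bounded, with $\|\mathcal X\|_{\rm op}:=\sup_{X\in\mathcal X}\|X\|_{\rm op}$. Let $L_1,\dots,L_T:\mathbb R^{d_L\times d_R}\to\mathbb R$ be independent random functions, each convex and differentiable, and let $L:\mathbb R^{d_L\times d_R}\to\mathbb R$ be twice differentiable with a global minimizer $x^*\in\mathcal X$. Assume that for every $t$ and every $x\in\mathcal X$ one has $\mathbb E[L_t(x)]=L(x)$ and $$\mathbb E\big[(\nabla L_t(x)-\nabla L(x))(\nabla L_t(x)-\nabla L(x))^\top\big]\preceq\Sigma$$ for a fixed positive semidefinite $\Sigma\in\mathbb R^{d\times d}$ (these expectations exist); if $\mathcal X$ has empty interior, assume moreover $\mathbb E[\nabla L_t(x)]=\nabla L(x)$ for every $t$ and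 $x\in\mathcal X$. *Left smoothness.* $H_{\rm left}(L)$ is the smallest $H\ge0$ for which there is $H^*\in\mathbb R^{d_L\times d_L}$ with $H=d_R\,\mathrm{Tr}(H^*)$ and $|\nabla^2L(X)[\Delta,\Delta]|\le\langle H^*,\Delta\Delta^\top\rangle$ for all $X,\Delta\in\mathbb R^{d_L\times d_R}$; it is assumed to be finite, i.e. such an $H$ exists. *Noise level.* $\sigma=\inf\sqrt{\langle\Sigma,H^{-1}\rangle}$ over all $H=A\otimes I_{d_R}$ with $A\in\mathbb R^{d_L\times d_L}$ positive definite and $\mathrm{Tr}(H)\le1$. *Iterates.* Let $\varepsilon\ge0$, $\eta=\sqrt{2/d_R}\,\|\mathcal X\|_{\rm op}$, and let $X_1\in\mathcal X$ be deterministic. Let $X_2,\dots,X_T$ be produced by one-sided Shampoo: with $G_t=\nabla L_t(X_t)$ and $\mathbf L_t=\varepsilon I_{d_L}+\frac1{d_R}\sum_{s\le t}G_sG_s^\top$, $$X_{t+1}\in\arg\min_{X\in\mathcal X}\big\|X_t-\eta\,\mathbf L_t^{-1/2}G_t-X\big\|_{\mathbf L_t^{1/2}\otimes I_{d_R}},\qquad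 \|x\|_H=\sqrt{x^\top Hx},$$ for $1\le t<T$; here the $\mathbf L_t$ are assumed positive definite (automatic if $\varepsilon>0$) and the minima attained (automatic if moreover $\mathcal X$ is closed). Then for $\bar x_{1:T}=\frac1T\sum_{t=1}^TX_t$ the random variable $L(\bar x_{1:T})-L(x^*)$ is integrable and $$\mathbb E\big[L(\bar x_{1:T})-L(x^*)\big]\le\frac{16}{Td_R}\|\mathcal X\|_{\rm op}^2H_{\rm left}(L)+\frac{4\sqrt2}{\sqrt{Td_R}}\|\mathcal X\|_{\rm op}\,\sigma+\frac{4\sqrt2\,d\sqrt\varepsilon}{T}\|\mathcal X\|_{\rm op}.$$ -/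

import Mathlib

open MeasureTheory ProbabilityTheory
open scoped Matrix Kronecker

noncomputable section

namespace Shampoo

/-- The parameter space `ℝ^d` with `d = m * n`. A coordinate is addressed by its row and column, so
that this is at the same time the space of `m × n` matrices with the Frobenius inner product. -/
abbrev Param (m n : ℕ) : Type := EuclideanSpace ℝ (Fin m × Fin n)

/-- The matrix form of a vector. -/
def toMat {m n : ℕ} (x : Param m n) : Matrix (Fin m) (Fin n) ℝ :=
  Matrix.of fun i j => x (i, j)

/-- The vector form of a matrix. -/
def toVec {m n : ℕ} (M : Matrix (Fin m) (Fin n) ℝ) : Param m n :=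
  WithLp.toLp 2 fun p => M p.1 p.2

/-- The operator norm of a matrix between Euclidean spaces (its largest singular value). -/
def opNorm {m n : ℕ} (M : Matrix (Fin m) (Fin n) ℝ) : ℝ :=
  ‖(Matrix.toEuclideanLin M).toContinuousLinearMap‖

/-- The size `‖𝒳‖_op = sup_{X ∈ 𝒳} ‖X‖_op` of a set. -/
def setOpNorm {m n : ℕ} (𝒳 : Set (Param m n)) : ℝ :=
  sSup ((fun x => opNorm (toMat x)) '' 𝒳)

/-- The preconditioner set `𝓗 = S₊^m ⊗ I_n`. -/
def preconditioners (m n : ℕ) : Set (Matrix (Fin m × Fin n) (Fin m × Fin n) ℝ) :=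
  {H | ∃ A : Matrix (Fin m) (Fin m) ℝ, A.PosSemidef ∧
    H = A ⊗ₖ (1 : Matrix (Fin n) (Fin n) ℝ)}

/-- The (semi-)norm `‖x‖_H = √(xᵀ H x)`. -/
def weightedNorm {m n : ℕ} (H : Matrix (Fin m × Fin n) (Fin m × Fin n) ℝ) (x : Param m n) : ℝ :=
  Real.sqrt (x.ofLp ⬝ᵥ (H *ᵥ x.ofLp))

/-- `z` is a projection of `y` onto `𝒳` with respect to `‖·‖_H`. -/
def IsProjection {m n : ℕ} (H : Matrix (Fin m × Fin n) (Fin m × Fin n) ℝ)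
    (𝒳 : Set (Param m n)) (y z : Param m n) : Prop :=
  z ∈ 𝒳 ∧ ∀ w ∈ 𝒳, weightedNorm H (y - z) ≤ weightedNorm H (y - w)

/-- The square root of a positive semidefinite matrix. -/
def matSqrt {m : ℕ} (A : Matrix (Fin m) (Fin m) ℝ) : Matrix (Fin m) (Fin m) ℝ :=
  cfc Real.sqrt A

/-- The accumulated matrix `L_t = ε I + (1/n) ∑_{s ≤ t} G_s G_sᵀ`. -/
def leftAccum {m n T : ℕ} (ε : ℝ) (G : Fin T → Matrix (Fin m) (Fin n) ℝ) (t : Fin T) :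
    Matrix (Fin m) (Fin m) ℝ :=
  ε • (1 : Matrix (Fin m) (Fin m) ℝ) + (1 / (n : ℝ)) • ∑ s ∈ Finset.Iic t, G s * (G s)ᵀ

/-- `x` is a run of one-sided Shampoo on the losses `ℓ`, with domain `𝒳`, learning rate `η`,
regularization `ε` and initialization `x₁`. The indices `0, …, T - 1` of `Fin T` stand for the steps
`1, …, T`. The update at step `t` uses the inverse square root of `L_t`, so it needs `L_t ≻ 0`; this
is automatic for `ε > 0`. -/
structure IsOneSidedShampoo {m n T : ℕ} (η ε : ℝ) (𝒳 : Set (Param m n)) (x₁ : Param m n)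
    (ℓ : Fin T → Param m n → ℝ) (x : Fin T → Param m n) : Prop where
  init : ∀ t : Fin T, t.val = 0 → x t = x₁
  posDef : ∀ t t' : Fin T, t'.val = t.val + 1 →
    (leftAccum ε (fun s => toMat (gradient (ℓ s) (x s))) t).PosDef
  step : ∀ t t' : Fin T, t'.val = t.val + 1 →
    IsProjection
      (matSqrt (leftAccum ε (fun s => toMat (gradient (ℓ s) (x s))) t) ⊗ₖ
        (1 : Matrix (Fin n) (Fin n) ℝ))
      𝒳
      (x t - η • toVec
        ((matSqrt (leftAccum ε (fun s => toMat (gradient (ℓ s) (x s))) t))⁻¹ *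
          toMat (gradient (ℓ t) (x t))))
      (x t')

/-- The values `H ≥ 0` of the form `H = n Tr(H*)`, where `H*` satisfies
`|∇²L(X)[Δ,Δ]| ≤ ⟨H*, Δ Δᵀ⟩` for all `X` and `Δ`. -/
def leftSmoothnessSet {m n : ℕ} (L : Param m n → ℝ) : Set ℝ :=
  {H | 0 ≤ H ∧ ∃ A : Matrix (Fin m) (Fin m) ℝ, H = n * A.trace ∧
    ∀ X Δ : Param m n,
      |fderiv ℝ (fderiv ℝ L) X Δ Δ| ≤ (Aᵀ * (toMat Δ * (toMat Δ)ᵀ)).trace}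

/-- The left smoothness `H_left(L)` (meaningful when `leftSmoothnessSet L` is not empty; the infimum
is then attained). -/
def leftSmoothness {m n : ℕ} (L : Param m n → ℝ) : ℝ :=
  sInf (leftSmoothnessSet L)

/-- The noise level `σ = inf √⟨S, H⁻¹⟩` over the invertible `H ∈ 𝓗` with `Tr H ≤ 1`. -/
def noiseLevel {m n : ℕ} (S : Matrix (Fin m × Fin n) (Fin m × Fin n) ℝ) : ℝ :=
  sInf {s | ∃ H ∈ preconditioners m n, H.PosDef ∧ H.trace ≤ 1 ∧
    s = Real.sqrt ((Sᵀ * H⁻¹).trace)}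

/-- The noise assumption: on `𝒳` the losses have expectation `L`, and the second moment matrix of
the gradient noise exists and is bounded by `S` in the Loewner order. -/
structure NoiseAssumption {Ω : Type*} [MeasurableSpace Ω] {m n T : ℕ} (μ : Measure Ω)
    (𝒳 : Set (Param m n)) (ℓ : Fin T → Ω → Param m n → ℝ) (L : Param m n → ℝ)
    (S : Matrix (Fin m × Fin n) (Fin m × Fin n) ℝ) : Prop where
  posSemidef : S.PosSemidef
  integrable : ∀ t, ∀ x ∈ 𝒳, Integrable (fun ω => ℓ t ω x) μ
  mean : ∀ t, ∀ x ∈ 𝒳, ∫ ω, ℓ t ω x ∂μ = L x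
  secondMoment : ∀ t, ∀ x ∈ 𝒳, MemLp (fun ω => gradient (ℓ t ω) x - gradient L x) 2 μ
  bound : ∀ t, ∀ x ∈ 𝒳,
    (S - Matrix.of fun p q => ∫ ω, (gradient (ℓ t ω) x - gradient L x) p *
      (gradient (ℓ t ω) x - gradient L x) q ∂μ).PosSemidef

end Shampoo

end

/-! Write `m`, `n` for the two dimensions, R for `setOpNorm 𝒳` and S_k for the square root of `ε I +
(1/n) ∑_{s < k} G_s G_sᵀ`.

Regret. The projected step is analysed in the norm of its own preconditioner S = S_{t+1}, with S₀ =
S_t. Changing the norm from S₀ to S costs at most D² tr(S - S₀), because S₀ ≤ S (the square root is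
operator monotone) and points of `𝒳` differ by at most D = 2R in operator norm. The second-order
term η²⟨S⁻¹, G Gᵀ⟩ is at most 2nη² tr(S - S₀), because A ↦ tr √A is concave. Both costs telescope,
and `IsOneSidedShampoo.regret_le` bounds the regret by a multiple of tr S_T.

Linearisation. For every positive definite P one has 2 tr S_T ≤ tr(P⁻¹ S_T²) + tr P, and the right
side is linear in the matrices G_t G_tᵀ. With a deterministic P the expectation can then be taken
term by term (`IsOneSidedShampoo.regret_le_variational`, `sum_integral_sub_le`).

Expectation. The iterate at step t depends only on earlier losses, so it is independent of the t-th
loss, and the noise at the iterate has conditional mean zero. Hence E⟨P⁻¹, G_t G_tᵀ⟩ splits into a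
noise part, at most ⟨Σ, P⁻¹ ⊗ I⟩, and a part from the true gradient. If H dominates the Hessian, the
global minimality of the reference point bounds ⟨H⁻¹, ∇L ∇Lᵀ⟩ by twice the optimality gap
(`quad_inv_gradient_le`).

Choice of P. Take P = p₁ I + p₂ H + p₃ A, with H from the left smoothness and A from the noise
level. Its inverse lies below that of each summand, so each error term meets the summand made for
it. The gap B then occurs on both sides. Choosing p₂ so that its right-hand coefficient is 1/2 lets
it be absorbed, and p₁ ≈ √ε, p₃ ≈ √T s balance the rest (`rate_of_forall_weights`). Jensen's
inequality and infima over H and A conclude. -/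

namespace Shampoo

/-! ### Trace inequalities and the Loewner order for real matrices. -/

section MatrixLemmas

variable {ι κ : Type*}

theorem transpose_eq_of_isHermitian {A : Matrix ι ι ℝ} (hA : A.IsHermitian) : Aᵀ = A := by
  rw [← Matrix.conjTranspose_eq_transpose_of_trivial]; exact hA

theorem posDef_smul_one_add [DecidableEq ι] {A : Matrix ι ι ℝ} (hA : A.PosSemidef) {δ : ℝ}
    (hδ : 0 < δ) : (A + δ • (1 : Matrix ι ι ℝ)).PosDef :=
  Matrix.PosDef.posSemidef_add hA (Matrix.PosDef.one.smul hδ)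

theorem posDef_of_sub_posSemidef {A B : Matrix ι ι ℝ} (hA : A.PosDef)
    (h : (B - A).PosSemidef) : B.PosDef := by
  simpa using hA.add_posSemidef h

variable [Fintype ι] [Fintype κ]

theorem exists_transpose_mul_self_of_posSemidef [DecidableEq ι] {B : Matrix ι ι ℝ}
    (hB : B.PosSemidef) : ∃ C : Matrix ι ι ℝ, B = Cᵀ * C := by
  open scoped MatrixOrder Matrix.Norms.L2Operator in
  obtain ⟨C, hC⟩ := CStarAlgebra.nonneg_iff_eq_star_mul_self.mp hB.nonneg
  exact ⟨C, by rw [hC, Matrix.star_eq_conjTranspose, Matrix.conjTranspose_eq_transpose_of_trivial]⟩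

theorem posSemidef_transpose_mul_mul {A : Matrix ι ι ℝ} (hA : A.PosSemidef)
    (C : Matrix ι κ ℝ) : (Cᵀ * A * C).PosSemidef := by
  have h := hA.conjTranspose_mul_mul_same C
  rwa [Matrix.conjTranspose_eq_transpose_of_trivial] at h

theorem posSemidef_mul_mul_transpose {A : Matrix κ κ ℝ} (hA : A.PosSemidef)
    (C : Matrix ι κ ℝ) : (C * A * Cᵀ).PosSemidef := by
  have h := hA.mul_mul_conjTranspose_same C
  rwa [Matrix.conjTranspose_eq_transpose_of_trivial] at h

theorem posSemidef_self_mul_transpose (C : Matrix ι κ ℝ) : (C * Cᵀ).PosSemidef := by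
  have h := Matrix.posSemidef_self_mul_conjTranspose C
  rwa [Matrix.conjTranspose_eq_transpose_of_trivial] at h

theorem trace_mul_nonneg [DecidableEq ι] {A B : Matrix ι ι ℝ} (hA : A.PosSemidef)
    (hB : B.PosSemidef) : 0 ≤ (A * B).trace := by
  obtain ⟨C, rfl⟩ := exists_transpose_mul_self_of_posSemidef hB
  have h := (posSemidef_mul_mul_transpose hA C).trace_nonneg
  rwa [Matrix.mul_assoc, Matrix.trace_mul_comm, Matrix.mul_assoc] at h

theorem trace_mul_le_trace_mul [DecidableEq ι] {A B P : Matrix ι ι ℝ}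
    (h : (B - A).PosSemidef) (hP : P.PosSemidef) : (A * P).trace ≤ (B * P).trace := by
  have := trace_mul_nonneg h hP
  rw [Matrix.sub_mul, Matrix.trace_sub] at this
  linarith

/-- The square root is operator monotone. -/
theorem posSemidef_sub_of_sq [DecidableEq ι] {A B : Matrix ι ι ℝ} (hA : A.PosSemidef)
    (hB : B.PosSemidef) (h : (B * B - A * A).PosSemidef) : (B - A).PosSemidef := by
  have hH : (B - A).IsHermitian := hB.1.sub hA.1
  rw [hH.posSemidef_iff_eigenvalues_nonneg]
  intro i
  by_contra! hneg
  simp only [Pi.zero_apply] at hneg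
  set v : ι → ℝ := (hH.eigenvectorBasis i).ofLp with hv
  set l := hH.eigenvalues i
  have hBA : (B - A) *ᵥ v = l • v := hH.mulVec_eigenvectorBasis i
  have hv0 : v ≠ 0 := by
    intro h0
    have := hH.eigenvectorBasis.orthonormal.ne_zero i
    apply this
    ext j
    exact congrFun h0 j
  have hvA := hA.dotProduct_mulVec_nonneg v
  have hvB := hB.dotProduct_mulVec_nonneg v
  have h1 := h.dotProduct_mulVec_nonneg v
  simp only [star_trivial] at hvA hvB h1
  have hBv : B *ᵥ v = A *ᵥ v + l • v := by rw [← hBA, Matrix.sub_mulVec]; abel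
  have sym : ∀ {M : Matrix ι ι ℝ}, M.IsHermitian → ∀ u w : ι → ℝ,
      u ⬝ᵥ M *ᵥ w = (M *ᵥ u) ⬝ᵥ w := by
    intro M hM u w
    rw [Matrix.dotProduct_mulVec, ← Matrix.mulVec_transpose, transpose_eq_of_isHermitian hM]
  -- For an eigenvector v of B - A with eigenvalue l < 0, the form of B² - A² factors as l times a
  -- nonnegative number. Being nonnegative too, it vanishes, and so do both forms vᵀAv and vᵀBv,
  -- which forces l |v|² = 0.
  have e : v ⬝ᵥ (B * B - A * A) *ᵥ v = l * (v ⬝ᵥ B *ᵥ v + v ⬝ᵥ A *ᵥ v) := by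
    have e1 : v ⬝ᵥ B *ᵥ v = v ⬝ᵥ A *ᵥ v + l * (v ⬝ᵥ v) := by
      rw [hBv]; simp
    rw [Matrix.sub_mulVec, dotProduct_sub, ← Matrix.mulVec_mulVec, ← Matrix.mulVec_mulVec,
      sym hB.1, sym hA.1, hBv]
    simp only [dotProduct_add, add_dotProduct, dotProduct_smul, smul_dotProduct, smul_eq_mul]
    rw [dotProduct_comm (A *ᵥ v) v]
    ring
  rw [e] at h1
  have hz : v ⬝ᵥ B *ᵥ v + v ⬝ᵥ A *ᵥ v = 0 := by nlinarith
  have hA0 : v ⬝ᵥ A *ᵥ v = 0 := by linarith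
  have hB0 : v ⬝ᵥ B *ᵥ v = 0 := by linarith
  have hvv : v ⬝ᵥ v = 0 := by
    have : v ⬝ᵥ B *ᵥ v = v ⬝ᵥ A *ᵥ v + l * (v ⬝ᵥ v) := by
      rw [hBv]; simp
    rw [hA0, hB0] at this
    have : l * (v ⬝ᵥ v) = 0 := by linarith
    exact (mul_eq_zero.mp this).resolve_left hneg.ne
  exact hv0 (dotProduct_self_eq_zero.mp hvv)

/-- Concavity of the trace of the square root. -/
theorem trace_inv_mul_sq_sub_le [DecidableEq ι] {S S₀ : Matrix ι ι ℝ} (hS : S.PosDef)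
    (hS₀ : S₀.PosSemidef) :
    (S⁻¹ * (S * S - S₀ * S₀)).trace ≤ 2 * (S.trace - S₀.trace) := by
  have hu : IsUnit S.det := (Matrix.isUnit_iff_isUnit_det _).mp hS.isUnit
  -- Everything follows from tr((S - S₀) S⁻¹ (S - S₀)) ≥ 0, a completed square.
  have h := (posSemidef_transpose_mul_mul hS.inv.posSemidef (S - S₀)).trace_nonneg
  rw [transpose_eq_of_isHermitian (hS.1.sub hS₀.1)] at h
  have e : (S - S₀) * S⁻¹ * (S - S₀) = S - S₀ - S₀ + S₀ * S⁻¹ * S₀ := by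
    rw [Matrix.sub_mul, Matrix.mul_nonsing_inv _ hu, Matrix.sub_mul, Matrix.one_mul,
      Matrix.mul_sub, Matrix.mul_assoc S₀ S⁻¹ S, Matrix.nonsing_inv_mul _ hu, Matrix.mul_one]
    abel
  rw [e, Matrix.trace_add, Matrix.trace_sub, Matrix.trace_sub,
    Matrix.mul_assoc, Matrix.trace_mul_comm] at h
  rw [Matrix.mul_sub, ← Matrix.mul_assoc, Matrix.nonsing_inv_mul _ hu, Matrix.one_mul,
    Matrix.trace_sub, ← Matrix.mul_assoc]
  linarith

/-- Matrix form of 2s ≤ s²/p + p, with equality at P = S when S is invertible. It replaces the trace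
of a square root by an expression linear in S². -/
theorem two_mul_trace_le [DecidableEq ι] {S P : Matrix ι ι ℝ} (hP : P.PosDef)
    (hS : S.PosSemidef) : 2 * S.trace ≤ (P⁻¹ * (S * S)).trace + P.trace := by
  have h := trace_inv_mul_sq_sub_le hP hS
  have hu : IsUnit P.det := (Matrix.isUnit_iff_isUnit_det _).mp hP.isUnit
  rw [Matrix.mul_sub, ← Matrix.mul_assoc, Matrix.nonsing_inv_mul _ hu, Matrix.one_mul,
    Matrix.trace_sub] at h
  linarith

/-- The inverse is operator antitone. -/
theorem posSemidef_inv_sub_inv [DecidableEq ι] {P Q : Matrix ι ι ℝ} (hQ : Q.PosDef)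
    (h : (P - Q).PosSemidef) : (Q⁻¹ - P⁻¹).PosSemidef := by
  have hP : P.PosDef := posDef_of_sub_posSemidef hQ h
  have huP : IsUnit P.det := (Matrix.isUnit_iff_isUnit_det _).mp hP.isUnit
  have huQ : IsUnit Q.det := (Matrix.isUnit_iff_isUnit_det _).mp hQ.isUnit
  have hPs : (P⁻¹)ᵀ = P⁻¹ := transpose_eq_of_isHermitian hP.inv.1
  have hEs : (P - Q)ᵀ = P - Q := transpose_eq_of_isHermitian h.1
  have a1 : P⁻¹ * (P - Q) * Q⁻¹ = Q⁻¹ - P⁻¹ := by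
    rw [Matrix.mul_sub, Matrix.nonsing_inv_mul _ huP, Matrix.sub_mul, Matrix.one_mul,
      Matrix.mul_assoc, Matrix.mul_nonsing_inv _ huQ, Matrix.mul_one]
  have a2 : Q⁻¹ * (P - Q) * P⁻¹ = Q⁻¹ - P⁻¹ := by
    rw [Matrix.mul_sub, Matrix.nonsing_inv_mul _ huQ, Matrix.sub_mul, Matrix.one_mul,
      Matrix.mul_assoc, Matrix.mul_nonsing_inv _ huP, Matrix.mul_one]
  -- With E = P - Q this is the resolvent identity applied twice: Q⁻¹ - P⁻¹ = P⁻¹EP⁻¹ + P⁻¹EQ⁻¹EP⁻¹,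
  -- where both terms are visibly positive semidefinite.
  have e : Q⁻¹ - P⁻¹ = (P⁻¹)ᵀ * (P - Q) * P⁻¹
      + ((P - Q) * P⁻¹)ᵀ * Q⁻¹ * ((P - Q) * P⁻¹) := by
    rw [Matrix.transpose_mul, hPs, hEs, a1, ← Matrix.mul_assoc, Matrix.sub_mul Q⁻¹ P⁻¹ (P - Q),
      Matrix.sub_mul _ _ P⁻¹, a2]
    abel
  rw [e]
  exact (posSemidef_transpose_mul_mul h _).add (posSemidef_transpose_mul_mul hQ.inv.posSemidef _)

/-- The quadratic form `⟨P, X Xᵀ⟩`. -/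
def quad (P : Matrix ι ι ℝ) (X : Matrix ι κ ℝ) : ℝ := (P * (X * Xᵀ)).trace

theorem quad_nonneg [DecidableEq ι] {P : Matrix ι ι ℝ} (hP : P.PosSemidef) (X : Matrix ι κ ℝ) :
    0 ≤ quad P X := trace_mul_nonneg hP (posSemidef_self_mul_transpose X)

theorem quad_sub_left (P Q : Matrix ι ι ℝ) (X : Matrix ι κ ℝ) :
    quad (P - Q) X = quad P X - quad Q X := by
  simp [quad, Matrix.sub_mul]

theorem quad_add_left (P Q : Matrix ι ι ℝ) (X : Matrix ι κ ℝ) :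
    quad (P + Q) X = quad P X + quad Q X := by
  simp [quad, Matrix.add_mul]

theorem quad_smul_left (c : ℝ) (P : Matrix ι ι ℝ) (X : Matrix ι κ ℝ) :
    quad (c • P) X = c * quad P X := by
  simp [quad]

theorem quad_mono [DecidableEq ι] {P Q : Matrix ι ι ℝ} (h : (Q - P).PosSemidef)
    (X : Matrix ι κ ℝ) : quad P X ≤ quad Q X := by
  have := quad_nonneg h X
  rw [quad_sub_left] at this
  linarith

theorem trace_mul_mul_transpose_comm {P : Matrix ι ι ℝ} (hP : P.IsHermitian)
    (X Y : Matrix ι κ ℝ) : (P * (X * Yᵀ)).trace = (P * (Y * Xᵀ)).trace := by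
  rw [← Matrix.trace_transpose, Matrix.transpose_mul, Matrix.transpose_mul,
    Matrix.transpose_transpose, transpose_eq_of_isHermitian hP, Matrix.trace_mul_comm]

theorem quad_sub_smul {P : Matrix ι ι ℝ} (hP : P.IsHermitian) (X Y : Matrix ι κ ℝ) (c : ℝ) :
    quad P (X - c • Y) = quad P X - 2 * c * (P * (X * Yᵀ)).trace + c ^ 2 * quad P Y := by
  have h := trace_mul_mul_transpose_comm hP X Y
  simp only [quad, Matrix.transpose_sub, Matrix.transpose_smul, Matrix.sub_mul, Matrix.mul_sub,
    Matrix.smul_mul, Matrix.mul_smul, Matrix.trace_sub, Matrix.trace_smul, smul_eq_mul]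
  rw [← h]; ring

/-- The preconditioner cancels in the cross term, leaving the plain Frobenius product of gradient
and displacement. -/
theorem quad_sub_smul_inv_mul [DecidableEq ι] {S : Matrix ι ι ℝ} (hS : S.PosDef)
    (X G : Matrix ι κ ℝ) (η : ℝ) :
    quad S (X - η • (S⁻¹ * G))
      = quad S X - 2 * η * (G * Xᵀ).trace + η ^ 2 * quad S⁻¹ G := by
  have hu : IsUnit S.det := (Matrix.isUnit_iff_isUnit_det _).mp hS.isUnit
  have e1 : S * (S⁻¹ * G) = G := by
    rw [← Matrix.mul_assoc, Matrix.mul_nonsing_inv _ hu, Matrix.one_mul]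
  rw [quad_sub_smul hS.1, trace_mul_mul_transpose_comm hS.1, ← Matrix.mul_assoc S (S⁻¹ * G) Xᵀ, e1]
  congr 2
  rw [quad, quad, ← Matrix.mul_assoc, e1, Matrix.transpose_mul,
    transpose_eq_of_isHermitian hS.inv.1, ← Matrix.mul_assoc, Matrix.trace_mul_comm]

end MatrixLemmas

/-! ### The matrix square root. -/

section Sqrt

variable {m : ℕ}

theorem matSqrt_posSemidef (A : Matrix (Fin m) (Fin m) ℝ) : (matSqrt A).PosSemidef := by
  open scoped MatrixOrder in
  exact Matrix.nonneg_iff_posSemidef.mp (cfc_nonneg fun x _ => Real.sqrt_nonneg x)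

theorem matSqrt_mul_self {A : Matrix (Fin m) (Fin m) ℝ} (hA : A.PosSemidef) :
    matSqrt A * matSqrt A = A := by
  have hsa : IsSelfAdjoint A := hA.1
  rw [matSqrt, ← cfc_mul Real.sqrt Real.sqrt A Real.continuous_sqrt.continuousOn
    Real.continuous_sqrt.continuousOn]
  conv_rhs => rw [← cfc_id ℝ A hsa]
  refine cfc_congr fun x hx => ?_
  have hx0 : 0 ≤ x := (Matrix.posSemidef_iff_isHermitian_and_spectrum_nonneg.mp hA).2 hx
  simp [Real.mul_self_sqrt hx0]

theorem matSqrt_posDef {A : Matrix (Fin m) (Fin m) ℝ} (hA : A.PosDef) : (matSqrt A).PosDef := by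
  rw [(matSqrt_posSemidef A).posDef_iff_det_ne_zero]
  intro h
  have h2 := matSqrt_mul_self hA.posSemidef
  have := hA.det_pos
  rw [← h2, Matrix.det_mul, h] at this
  simp at this

theorem continuousOn_matSqrt :
    ContinuousOn (matSqrt (m := m)) {A | A.IsHermitian} := by
  open scoped Matrix.Norms.L2Operator in
  exact ContinuousOn.cfc_of_mem_nhdsSet (s := Set.univ) (p := IsSelfAdjoint) (𝕜 := ℝ) Real.sqrt
    (a := fun A : Matrix (Fin m) (Fin m) ℝ => A)
    Filter.univ_mem continuousOn_id (fun A hA => hA) Real.continuous_sqrt.continuousOn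

end Sqrt

/-! ### The operator norm and its effect on traces. -/

section OpNorm

variable {m n : ℕ}

theorem opNorm_sub_le (M N : Matrix (Fin m) (Fin n) ℝ) : opNorm (M - N) ≤ opNorm M + opNorm N := by
  simp only [opNorm, map_sub]
  exact norm_sub_le _ _

theorem opNorm_nonneg (M : Matrix (Fin m) (Fin n) ℝ) : 0 ≤ opNorm M := norm_nonneg _

theorem continuous_opNorm_toMat : Continuous fun x : Param m n => opNorm (toMat x) := by
  let f : Param m n →ₗ[ℝ] (EuclideanSpace ℝ (Fin n) →L[ℝ] EuclideanSpace ℝ (Fin m)) :=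
    { toFun := fun x => (Matrix.toEuclideanLin (toMat x)).toContinuousLinearMap
      map_add' := fun x y => by
        have : toMat (x + y) = toMat x + toMat y := rfl
        rw [this, map_add, map_add]
      map_smul' := fun c x => by
        have : toMat (c • x) = c • toMat x := rfl
        rw [this, map_smul, map_smul, RingHom.id_apply] }
  exact f.continuous_of_finiteDimensional.norm

/-- Trace duality: X Xᵀ ≤ D² I, paired with P ≥ 0. This is why the operator norm, rather than the
Frobenius norm, measures the domain. -/
theorem quad_le_of_opNorm_le {P : Matrix (Fin m) (Fin m) ℝ} (hP : P.PosSemidef)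
    {X : Matrix (Fin m) (Fin n) ℝ} {D : ℝ} (hX : opNorm X ≤ D) :
    quad P X ≤ D ^ 2 * P.trace := by
  have h : (D ^ 2 • (1 : Matrix (Fin m) (Fin m) ℝ) - X * Xᵀ).PosSemidef := by
    refine Matrix.PosSemidef.of_dotProduct_mulVec_nonneg ?_ fun v => ?_
    · exact (Matrix.isHermitian_one.smul (IsSelfAdjoint.all _)).sub
        (posSemidef_self_mul_transpose X).1
    · have key : ‖WithLp.toLp 2 (Xᵀ *ᵥ v)‖ ≤ D * ‖WithLp.toLp 2 v‖ := by
        open scoped Matrix.Norms.L2Operator in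
        have h1 := Matrix.l2_opNorm_mulVec Xᴴ (WithLp.toLp 2 v)
        have h2 : ‖Xᴴ‖ = opNorm X := by
          rw [Matrix.l2_opNorm_conjTranspose, Matrix.l2_opNorm_def]; rfl
        rw [h2, Matrix.conjTranspose_eq_transpose_of_trivial] at h1
        exact h1.trans (mul_le_mul_of_nonneg_right hX (norm_nonneg _))
      have hD : 0 ≤ D := (opNorm_nonneg X).trans hX
      have k2 := mul_self_le_mul_self (norm_nonneg _) key
      have n1 : ∀ {k : ℕ} (u : Fin k → ℝ), ‖WithLp.toLp 2 u‖ * ‖WithLp.toLp 2 u‖ = u ⬝ᵥ u := by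
        intro k u
        rw [← real_inner_self_eq_norm_mul_norm]
        rw [PiLp.inner_apply]
        rfl
      rw [n1, mul_mul_mul_comm, n1] at k2
      simp only [star_trivial, Matrix.sub_mulVec, dotProduct_sub, Matrix.smul_mulVec,
        Matrix.one_mulVec, dotProduct_smul, smul_eq_mul]
      rw [← Matrix.mulVec_mulVec, Matrix.dotProduct_mulVec, ← Matrix.mulVec_transpose]
      linarith [sq D]
  have h2 := trace_mul_le_trace_mul h hP
  rw [Matrix.smul_mul, Matrix.one_mul, Matrix.trace_smul, smul_eq_mul] at h2
  rwa [quad, Matrix.trace_mul_comm]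

end OpNorm

/-! ### Dictionary between vectors and matrices for preconditioners `A ⊗ I`. -/

section Vec

variable {m n : ℕ}

theorem inner_eq_trace (x y : Param m n) : inner ℝ x y = (toMat x * (toMat y)ᵀ).trace := by
  simp only [PiLp.inner_apply, Matrix.trace, Matrix.diag, Matrix.mul_apply, toMat,
    Matrix.transpose_apply, Matrix.of_apply, Fintype.sum_prod_type]
  simp [mul_comm]

theorem toMat_sub (x y : Param m n) : toMat (x - y) = toMat x - toMat y := rfl
theorem toMat_add (x y : Param m n) : toMat (x + y) = toMat x + toMat y := rfl
theorem toMat_smul (c : ℝ) (x : Param m n) : toMat (c • x) = c • toMat x := rfl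
theorem toMat_toVec (M : Matrix (Fin m) (Fin n) ℝ) : toMat (toVec M) = M := rfl

theorem kronecker_one_mulVec (A : Matrix (Fin m) (Fin m) ℝ) (x : Param m n) :
    (A ⊗ₖ (1 : Matrix (Fin n) (Fin n) ℝ)) *ᵥ x.ofLp = (toVec (A * toMat x)).ofLp := by
  ext ⟨i, j⟩
  simp [Matrix.mulVec, dotProduct, toVec, toMat, Matrix.mul_apply, Fintype.sum_prod_type,
    Matrix.kroneckerMap_apply, Matrix.one_apply]

theorem dotProduct_kronecker_one_mulVec (A : Matrix (Fin m) (Fin m) ℝ) (x y : Param m n) :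
    x.ofLp ⬝ᵥ ((A ⊗ₖ (1 : Matrix (Fin n) (Fin n) ℝ)) *ᵥ y.ofLp)
      = (A * (toMat y * (toMat x)ᵀ)).trace := by
  rw [kronecker_one_mulVec, ← Matrix.mul_assoc, ← toMat_toVec (A * toMat y), ← inner_eq_trace,
    PiLp.inner_apply]
  rfl

theorem weightedNorm_kronecker_one (A : Matrix (Fin m) (Fin m) ℝ) (x : Param m n) :
    weightedNorm (A ⊗ₖ (1 : Matrix (Fin n) (Fin n) ℝ)) x = Real.sqrt (quad A (toMat x)) := by
  rw [weightedNorm, dotProduct_kronecker_one_mulVec, quad]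

theorem quad_pos {A : Matrix (Fin m) (Fin m) ℝ} (hA : A.PosDef) {x : Param m n} (hx : x ≠ 0) :
    0 < quad A (toMat x) := by
  have hK : (A ⊗ₖ (1 : Matrix (Fin n) (Fin n) ℝ)).PosDef := hA.kronecker Matrix.PosDef.one
  have := hK.dotProduct_mulVec_pos (x := x.ofLp) (by
    intro h; apply hx; ext i; exact congrFun h i)
  rwa [star_trivial, dotProduct_kronecker_one_mulVec] at this

end Vec

theorem le_of_forall_pos_le_add_mul {a b c : ℝ} (h : ∀ δ : ℝ, 0 < δ → a ≤ b + δ * c) : a ≤ b := by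
  have ht : Filter.Tendsto (fun δ : ℝ => b + δ * c) (nhdsWithin 0 (Set.Ioi 0)) (nhds b) := by
    have : Continuous fun δ : ℝ => b + δ * c := by fun_prop
    have h0 := this.tendsto 0
    simp only [zero_mul, add_zero] at h0
    exact h0.mono_left nhdsWithin_le_nhds
  exact ge_of_tendsto ht (Filter.eventually_of_mem self_mem_nhdsWithin fun δ hδ => h δ hδ)

/-! ### Projections in a weighted norm. -/

section Projection

variable {m n : ℕ}

theorem IsProjection.quad_le {S : Matrix (Fin m) (Fin m) ℝ} (hS : S.PosSemidef)
    {𝒳 : Set (Param m n)} {y z : Param m n}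
    (h : IsProjection (S ⊗ₖ (1 : Matrix (Fin n) (Fin n) ℝ)) 𝒳 y z) {w : Param m n} (hw : w ∈ 𝒳) :
    quad S (toMat (y - z)) ≤ quad S (toMat (y - w)) := by
  have := h.2 w hw
  rw [weightedNorm_kronecker_one, weightedNorm_kronecker_one] at this
  exact (Real.sqrt_le_sqrt_iff (quad_nonneg hS _)).mp this

/-- The variational inequality characterising a projection onto a convex set. -/
theorem quad_add_quad_le {S : Matrix (Fin m) (Fin m) ℝ} (hS : S.PosSemidef)
    {𝒳 : Set (Param m n)} (hconv : Convex ℝ 𝒳) {y z : Param m n} (hz : z ∈ 𝒳)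
    (h : ∀ w ∈ 𝒳, quad S (toMat (y - z)) ≤ quad S (toMat (y - w)))
    {w : Param m n} (hw : w ∈ 𝒳) :
    quad S (toMat (y - z)) + quad S (toMat (z - w)) ≤ quad S (toMat (y - w)) := by
  have expand : ∀ c : ℝ, quad S (toMat (y - (z + c • (w - z)))) = quad S (toMat (y - z))
      - 2 * c * (S * (toMat (y - z) * (toMat (w - z))ᵀ)).trace
      + c ^ 2 * quad S (toMat (w - z)) := by
    intro c
    rw [← sub_sub, toMat_sub (y - z), toMat_smul, quad_sub_smul hS.1]
  have hc : (S * (toMat (y - z) * (toMat (w - z))ᵀ)).trace ≤ 0 := by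
    refine le_of_forall_pos_le_add_mul (c := quad S (toMat (w - z))) fun δ hδ => ?_
    -- A point of the segment from z to w at parameter c; capping at 1 keeps it in `𝒳`, and c → 0
    -- yields the first-order condition.
    set c := min δ 1 with hcd
    have hc0 : 0 < c := lt_min hδ one_pos
    have hm : z + c • (w - z) ∈ 𝒳 :=
      hconv.add_smul_sub_mem hz hw ⟨hc0.le, min_le_right _ _⟩
    have h1 := h _ hm
    rw [expand] at h1
    have hq := quad_nonneg hS (toMat (w - z))
    have h2 : 2 * (S * (toMat (y - z) * (toMat (w - z))ᵀ)).trace ≤ c * quad S (toMat (w - z)) := by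
      have : 0 ≤ c * (c * quad S (toMat (w - z))
        - 2 * (S * (toMat (y - z) * (toMat (w - z))ᵀ)).trace) := by linarith
      linarith [nonneg_of_mul_nonneg_right this hc0]
    have h3 : c * quad S (toMat (w - z)) ≤ δ * quad S (toMat (w - z)) :=
      mul_le_mul_of_nonneg_right (min_le_left _ _) hq
    have h4 : 0 ≤ δ * quad S (toMat (w - z)) := by positivity
    linarith
  have e := expand 1
  rw [one_smul, add_sub_cancel] at e
  have e2 : quad S (toMat (z - w)) = quad S (toMat (w - z)) := by
    rw [← neg_sub w z]
    have : toMat (-(w - z)) = -toMat (w - z) := rfl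
    rw [this]; simp [quad]
  rw [e, e2]
  linarith

end Projection

/-! ### Deterministic regret bound. -/

section Regret

variable {m n T : ℕ}

/-- The accumulated matrix `ε I + (1/n) ∑_{s < k} G_s G_sᵀ`. -/
noncomputable def accum (ε : ℝ) (G : Fin T → Matrix (Fin m) (Fin n) ℝ) (k : ℕ) :
    Matrix (Fin m) (Fin m) ℝ :=
  ε • (1 : Matrix (Fin m) (Fin m) ℝ)
    + (1 / (n : ℝ)) • ∑ s ∈ Finset.univ.filter (fun s : Fin T => s.val < k), G s * (G s)ᵀ

theorem leftAccum_eq_accum (ε : ℝ) (G : Fin T → Matrix (Fin m) (Fin n) ℝ) (t : Fin T) :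
    leftAccum ε G t = accum ε G (t.val + 1) := by
  unfold leftAccum accum
  have : Finset.Iic t = Finset.univ.filter (fun s : Fin T => s.val < t.val + 1) := by
    refine Finset.ext fun s => ?_
    rw [Finset.mem_Iic, Finset.mem_filter, Fin.le_def, Nat.lt_succ_iff]
    simp
  rw [this]

theorem accum_posSemidef {ε : ℝ} (hε : 0 ≤ ε) (G : Fin T → Matrix (Fin m) (Fin n) ℝ) (k : ℕ) :
    (accum ε G k).PosSemidef :=
  (Matrix.PosSemidef.one.smul hε).add
    ((Matrix.posSemidef_sum _ fun _ _ => posSemidef_self_mul_transpose _).smul (by positivity))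

theorem filter_val_lt_succ (t : Fin T) :
    Finset.univ.filter (fun s : Fin T => s.val < t.val + 1)
      = insert t (Finset.univ.filter (fun s : Fin T => s.val < t.val)) := by
  ext s
  simp only [Finset.mem_filter, Finset.mem_univ, true_and, Finset.mem_insert, Fin.ext_iff]
  omega

theorem accum_succ (ε : ℝ) (G : Fin T → Matrix (Fin m) (Fin n) ℝ) (t : Fin T) :
    accum ε G (t.val + 1) = accum ε G t.val + (1 / (n : ℝ)) • (G t * (G t)ᵀ) := by
  unfold accum
  rw [filter_val_lt_succ, Finset.sum_insert (by simp), smul_add]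
  abel

theorem accum_top (ε : ℝ) (G : Fin T → Matrix (Fin m) (Fin n) ℝ) :
    accum ε G T = ε • (1 : Matrix (Fin m) (Fin m) ℝ)
      + (1 / (n : ℝ)) • ∑ s, G s * (G s)ᵀ := by
  simp [accum]

/-- One step of the potential argument: the D² term pays for the change of norm, the 2nη² term for
the squared gradient, and both are multiples of the same telescoping trace. The hypothesis `hsq` is
an inequality so that a regularised root is also admitted as S. -/
theorem quad_step_le (hn : 0 < n) {S S₀ : Matrix (Fin m) (Fin m) ℝ} (hS : S.PosDef)
    (hS₀ : S₀.PosSemidef) {X G : Matrix (Fin m) (Fin n) ℝ} {D η : ℝ}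
    (hsq : (S * S - S₀ * S₀ - (1 / (n : ℝ)) • (G * Gᵀ)).PosSemidef) (hX : opNorm X ≤ D) :
    quad S (X - η • (S⁻¹ * G)) ≤ quad S₀ X - 2 * η * (G * Xᵀ).trace
      + (D ^ 2 + 2 * n * η ^ 2) * (S.trace - S₀.trace) := by
  have hn' : (0 : ℝ) < n := by exact_mod_cast hn
  have hdiff : (S - S₀).PosSemidef := by
    refine posSemidef_sub_of_sq hS₀ hS.posSemidef ?_
    have := hsq.add ((posSemidef_self_mul_transpose G).smul (a := 1 / (n : ℝ)) (by positivity))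
    rwa [sub_add_cancel] at this
  have h1 := quad_le_of_opNorm_le hdiff hX
  rw [quad_sub_left, Matrix.trace_sub] at h1
  have h2 := trace_inv_mul_sq_sub_le hS hS₀
  have h3 := trace_mul_nonneg hS.inv.posSemidef hsq
  rw [Matrix.mul_sub, Matrix.trace_sub, Matrix.mul_smul, Matrix.trace_smul, smul_eq_mul] at h3
  have h4 : quad S⁻¹ G ≤ 2 * n * (S.trace - S₀.trace) := by
    have : (1 / (n : ℝ)) * quad S⁻¹ G ≤ 2 * (S.trace - S₀.trace) := by
      unfold quad; linarith
    rw [one_div, inv_mul_le_iff₀ hn'] at this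
    linarith
  rw [quad_sub_smul_inv_mul hS]
  nlinarith [sq_nonneg η]

theorem IsOneSidedShampoo.mem {η ε : ℝ} {𝒳 : Set (Param m n)} {x₁ : Param m n}
    {ℓ : Fin T → Param m n → ℝ} {x : Fin T → Param m n}
    (h : IsOneSidedShampoo η ε 𝒳 x₁ ℓ x) (hx₁ : x₁ ∈ 𝒳) (t : Fin T) : x t ∈ 𝒳 := by
  obtain ⟨k, hk⟩ := t
  cases k with
  | zero => rw [h.init ⟨0, hk⟩ rfl]; exact hx₁
  | succ k => exact (h.step ⟨k, by omega⟩ ⟨k + 1, hk⟩ rfl).1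

/-- The regret of one-sided Shampoo against a point of the domain. -/
theorem IsOneSidedShampoo.regret_le {η ε : ℝ} {𝒳 : Set (Param m n)} {x₁ : Param m n}
    {ℓ : Fin T → Param m n → ℝ} {x : Fin T → Param m n}
    (h : IsOneSidedShampoo η ε 𝒳 x₁ ℓ x) (hx₁ : x₁ ∈ 𝒳) (hconv : Convex ℝ 𝒳)
    (hn : 0 < n) (hT : 0 < T) (hε : 0 ≤ ε) {w : Param m n} (hw : w ∈ 𝒳) {D : ℝ}
    (hD : ∀ z ∈ 𝒳, opNorm (toMat (z - w)) ≤ D) :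
    2 * η * ∑ t, inner ℝ (gradient (ℓ t) (x t)) (x t - w)
      ≤ (D ^ 2 + 2 * n * η ^ 2)
        * (matSqrt (accum ε (fun s => toMat (gradient (ℓ s) (x s))) T)).trace := by
  set G : Fin T → Matrix (Fin m) (Fin n) ℝ := fun s => toMat (gradient (ℓ s) (x s)) with hG
  set S : ℕ → Matrix (Fin m) (Fin m) ℝ := fun k => matSqrt (accum ε G k) with hSdef
  set C : ℝ := D ^ 2 + 2 * n * η ^ 2 with hC
  have hSS : ∀ k, S k * S k = accum ε G k := fun k => matSqrt_mul_self (accum_posSemidef hε G k)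
  have hSp : ∀ k, (S k).PosSemidef := fun k => matSqrt_posSemidef _
  have hsq : ∀ t : Fin T, S (t.val + 1) * S (t.val + 1) - S t.val * S t.val
      - (1 / (n : ℝ)) • (G t * (G t)ᵀ) = 0 := by
    intro t
    rw [hSS, hSS, accum_succ]
    abel
  have hin : ∀ t : Fin T, inner ℝ (gradient (ℓ t) (x t)) (x t - w)
      = (G t * (toMat (x t - w))ᵀ).trace := fun t => inner_eq_trace _ _
  -- The potential: accumulated regret plus the current distance to w, measured in the norm of S_k.
  have claim : ∀ k (hk : k < T),
      2 * η * ∑ s ∈ Finset.univ.filter (fun s : Fin T => s.val < k),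
          inner ℝ (gradient (ℓ s) (x s)) (x s - w) + quad (S k) (toMat (x ⟨k, hk⟩ - w))
        ≤ C * (S k).trace := by
    intro k
    induction k with
    | zero =>
      intro hk
      have h1 := quad_le_of_opNorm_le (hSp 0) (hD _ (h.mem hx₁ ⟨0, hk⟩))
      have h2 := (hSp 0).trace_nonneg
      have h3 : 0 ≤ 2 * n * η ^ 2 * (S 0).trace := by positivity
      simp only [not_lt_zero, Finset.filter_false, Finset.sum_empty, mul_zero, zero_add]
      rw [hC, add_mul]; linarith
    | succ k ih =>
      intro hk
      have hk' : k < T := by omega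
      set t : Fin T := ⟨k, hk'⟩ with ht
      set t' : Fin T := ⟨k + 1, hk⟩ with ht'
      have hpd : (S (k + 1)).PosDef := by
        have := h.posDef t t' rfl
        rw [leftAccum_eq_accum] at this
        exact matSqrt_posDef this
      have hst := h.step t t' rfl
      rw [leftAccum_eq_accum] at hst
      have hpr := quad_add_quad_le (hSp (k + 1)) hconv hst.1
        (fun v hv => IsProjection.quad_le (hSp (k + 1)) hst hv) hw
      have hnn := quad_nonneg (hSp (k + 1)) (toMat (x t - η • toVec ((S (k + 1))⁻¹ * G t) - x t'))
      have e : toMat (x t - η • toVec ((S (k + 1))⁻¹ * G t) - w)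
          = toMat (x t - w) - η • ((S (k + 1))⁻¹ * G t) := by
        rw [sub_right_comm]; rfl
      have hst2 := quad_step_le hn hpd (hSp k) (X := toMat (x t - w)) (G := G t) (D := D) (η := η)
        (by rw [hsq t]; exact Matrix.PosSemidef.zero) (hD _ (h.mem hx₁ t))
      have hpr' : quad (S (k + 1)) (toMat (x t - η • toVec ((S (k + 1))⁻¹ * G t) - x t'))
          + quad (S (k + 1)) (toMat (x t' - w))
          ≤ quad (S (k + 1)) (toMat (x t - η • toVec ((S (k + 1))⁻¹ * G t) - w)) := hpr
      rw [e] at hpr'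
      have hi := ih hk'
      have hf := filter_val_lt_succ t
      rw [show (k + 1) = t.val + 1 from rfl, hf, Finset.sum_insert (by simp), hin t]
      change _ + quad (S (k + 1)) (toMat (x t' - w)) ≤ C * (S (k + 1)).trace
      change 2 * η * ∑ s ∈ Finset.univ.filter (fun s : Fin T => s.val < t.val), _ + _ ≤ _ at hi
      rw [mul_add]
      linarith
  have hlast := claim (T - 1) (by omega)
  set t : Fin T := ⟨T - 1, by omega⟩ with ht
  have hTt : T = t.val + 1 := by simp [ht]; omega
  have hsum : ∑ s, inner ℝ (gradient (ℓ s) (x s)) (x s - w)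
      = (G t * (toMat (x t - w))ᵀ).trace + ∑ s ∈ Finset.univ.filter (fun s : Fin T => s.val < T - 1),
        inner ℝ (gradient (ℓ s) (x s)) (x s - w) := by
    rw [← hin t]
    have hf := filter_val_lt_succ t
    rw [← hTt] at hf
    have hu : Finset.univ.filter (fun s : Fin T => s.val < T) = Finset.univ := by simp
    calc _ = ∑ s ∈ Finset.univ.filter (fun s : Fin T => s.val < T), _ := by rw [hu]
      _ = _ := by rw [hf, Finset.sum_insert (by simp)]
  -- The last gradient is followed by no projection, so its step is purely virtual. Positive
  -- definiteness is not assumed there (S_T can be singular if `ε = 0` and `T = 1`), hence the shift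
  -- by δ I, which costs δ m in the trace.
  refine le_of_forall_pos_le_add_mul (c := C * m) fun δ hδ => ?_
  have hST : S T = S (t.val + 1) := by rw [← hTt]
  have hpd : (S T + δ • 1).PosDef := posDef_smul_one_add (hSp T) hδ
  have hst2 := quad_step_le hn hpd (hSp (T - 1)) (X := toMat (x t - w)) (G := G t) (D := D) (η := η)
    (by
      have e : (S T + δ • 1) * (S T + δ • 1) - S (T - 1) * S (T - 1)
          - (1 / (n : ℝ)) • (G t * (G t)ᵀ) = (2 * δ) • S T + (δ * δ) • 1 := by
        have h0 := hsq t
        rw [← hST] at h0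
        change S T * S T - S (T - 1) * S (T - 1) - _ = 0 at h0
        have : (S T + δ • 1) * (S T + δ • 1)
            = S T * S T + ((2 * δ) • S T + (δ * δ) • (1 : Matrix (Fin m) (Fin m) ℝ)) := by
          simp only [Matrix.add_mul, Matrix.mul_add, Matrix.smul_mul, Matrix.mul_smul,
            Matrix.one_mul, Matrix.mul_one]
          module
        rw [this, add_sub_right_comm, add_sub_right_comm, h0, zero_add]
      rw [e]
      exact ((hSp T).smul (by positivity)).add (Matrix.PosSemidef.one.smul (by positivity)))
    (hD _ (h.mem hx₁ t))
  have hnn := quad_nonneg hpd.posSemidef (toMat (x t - w) - η • ((S T + δ • 1)⁻¹ * G t))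
  rw [Matrix.trace_add, Matrix.trace_smul, Matrix.trace_one, Fintype.card_fin, smul_eq_mul] at hst2
  rw [hsum, mul_add]
  have hlin : C * ((S T).trace + δ * m - (S (T - 1)).trace)
    = C * (S T).trace + δ * (C * m) - C * (S (T - 1)).trace := by ring
  rw [← hC, hlin] at hst2
  linarith

end Regret

/-! ### Consequences of left smoothness. -/

section Smoothness

/-- The second derivative is bounded above but not assumed integrable, so monotonicity is used twice
in place of the integral remainder. -/
theorem le_of_hasDerivAt_hasDerivAt_le {f f' f'' : ℝ → ℝ} {C : ℝ}
    (hf : ∀ s, HasDerivAt f (f' s) s) (hf' : ∀ s, HasDerivAt f' (f'' s) s) (hC : ∀ s, f'' s ≤ C) :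
    f 1 ≤ f 0 + f' 0 + C / 2 := by
  have h1 : ∀ s, HasDerivAt (fun s => f' s - C * s) (f'' s - C) s := fun s => by
    have := (hf' s).sub ((hasDerivAt_id s).const_mul C)
    rw [mul_one] at this
    exact this
  have a1 : Antitone fun s => f' s - C * s :=
    antitone_of_deriv_nonpos (fun s => (h1 s).differentiableAt) fun s => by
      rw [(h1 s).deriv]; linarith [hC s]
  have h2 : ∀ s, HasDerivAt (fun s => f s - f' 0 * s - C / 2 * s ^ 2)
      (f' s - f' 0 - C * s) s := fun s => by
    have := ((hf s).sub ((hasDerivAt_id s).const_mul (f' 0))).sub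
      ((hasDerivAt_pow 2 s).const_mul (C / 2))
    refine this.congr_deriv ?_
    norm_num
    ring
  have a2 : AntitoneOn (fun s => f s - f' 0 * s - C / 2 * s ^ 2) (Set.Icc 0 1) := by
    refine antitoneOn_of_deriv_nonpos (convex_Icc 0 1)
      (fun s _ => (h2 s).continuousAt.continuousWithinAt)
      (fun s _ => (h2 s).differentiableAt.differentiableWithinAt) fun s hs => ?_
    rw [interior_Icc] at hs
    rw [(h2 s).deriv]
    have := a1 hs.1.le
    simp only [mul_zero, sub_zero] at this
    linarith
  have := a2 (Set.left_mem_Icc.mpr zero_le_one) (Set.right_mem_Icc.mpr zero_le_one) zero_le_one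
  norm_num at this
  linarith

theorem le_add_fderiv_add {E : Type*} [NormedAddCommGroup E] [NormedSpace ℝ E] {L : E → ℝ}
    (hL : Differentiable ℝ L) (hL2 : Differentiable ℝ (fderiv ℝ L)) (x v : E) {C : ℝ}
    (hC : ∀ y, fderiv ℝ (fderiv ℝ L) y v v ≤ C) :
    L (x + v) ≤ L x + fderiv ℝ L x v + C / 2 := by
  have hline : ∀ s : ℝ, HasDerivAt (fun s : ℝ => x + s • v) v s := fun s => by
    simpa using ((hasDerivAt_id s).smul_const v).const_add x
  have h1 : ∀ s : ℝ, HasDerivAt (fun s : ℝ => L (x + s • v)) (fderiv ℝ L (x + s • v) v) s :=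
    fun s => (hL (x + s • v)).hasFDerivAt.comp_hasDerivAt s (hline s)
  have h2 : ∀ s : ℝ, HasDerivAt (fun s : ℝ => fderiv ℝ L (x + s • v) v)
      (fderiv ℝ (fderiv ℝ L) (x + s • v) v v) s := fun s => by
    have := (hL2 (x + s • v)).hasFDerivAt.comp_hasDerivAt s (hline s)
    exact (ContinuousLinearMap.apply ℝ ℝ v).hasFDerivAt.comp_hasDerivAt s this
  simpa using le_of_hasDerivAt_hasDerivAt_le h1 h2 fun s => hC _

variable {m n : ℕ}

/-- A member of the left smoothness set is, up to an arbitrarily small error, realised by a positive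
definite matrix. -/
theorem exists_posDef_of_mem_leftSmoothnessSet (hn : 0 < n) {L : Param m n → ℝ} {H : ℝ}
    (hH : H ∈ leftSmoothnessSet L) {δ : ℝ} (hδ : 0 < δ) :
    ∃ P : Matrix (Fin m) (Fin m) ℝ, P.PosDef ∧ n * P.trace = H + δ * (n * m) ∧
      ∀ X Δ : Param m n, fderiv ℝ (fderiv ℝ L) X Δ Δ ≤ quad P (toMat Δ) := by
  obtain ⟨-, A, rfl, hA⟩ := hH
  have hquadT : ∀ X : Matrix (Fin m) (Fin n) ℝ, quad Aᵀ X = quad A X := by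
    intro X
    rw [quad, quad, ← Matrix.trace_transpose, Matrix.transpose_mul, Matrix.transpose_mul,
      Matrix.transpose_transpose, Matrix.transpose_transpose, Matrix.trace_mul_comm]
  have hquad : ∀ X : Matrix (Fin m) (Fin n) ℝ, quad ((1 / 2 : ℝ) • (A + Aᵀ)) X = quad Aᵀ X := by
    intro X
    rw [quad_smul_left, quad_add_left, hquadT]
    ring
  have hpsd : ((1 / 2 : ℝ) • (A + Aᵀ)).PosSemidef := by
    refine Matrix.PosSemidef.of_dotProduct_mulVec_nonneg ?_ fun v => ?_
    · rw [Matrix.IsHermitian, Matrix.conjTranspose_eq_transpose_of_trivial]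
      simp [add_comm]
    -- A matrix with single nonzero column v has X Xᵀ = v vᵀ, so the smoothness inequality, whose
    -- left side is an absolute value, makes the symmetric part of A positive semidefinite.
    · let X : Matrix (Fin m) (Fin n) ℝ := Matrix.of fun i j => if j = ⟨0, hn⟩ then v i else 0
      have h1 := (abs_nonneg _).trans (hA 0 (toVec X))
      rw [toMat_toVec] at h1
      change 0 ≤ quad Aᵀ X at h1
      rw [← hquad] at h1
      have hX : X * Xᵀ = Matrix.vecMulVec v v := by
        ext i j
        simp [X, Matrix.mul_apply, Matrix.vecMulVec_apply]
      rw [quad, hX, Matrix.mul_vecMulVec, Matrix.trace_vecMulVec] at h1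
      rwa [star_trivial, dotProduct_comm]
  refine ⟨(1 / 2 : ℝ) • (A + Aᵀ) + δ • 1, posDef_smul_one_add hpsd hδ, ?_, fun X Δ => ?_⟩
  · simp [Matrix.trace_transpose]
    ring
  · rw [quad_add_left, hquad, quad_smul_left]
    have h1 := (le_abs_self _).trans (hA X Δ)
    have h2 := quad_nonneg (Matrix.PosSemidef.one) (toMat Δ)
    have h3 : 0 ≤ δ * quad 1 (toMat Δ) := by positivity
    unfold quad at h3 ⊢
    linarith

/-- The gradient of a smooth function with a global minimiser is controlled by the optimality
gap. -/
theorem quad_inv_gradient_le {L : Param m n → ℝ} (hL : Differentiable ℝ L)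
    (hL2 : Differentiable ℝ (fderiv ℝ L)) {P : Matrix (Fin m) (Fin m) ℝ} (hP : P.PosDef)
    (hbound : ∀ X Δ : Param m n, fderiv ℝ (fderiv ℝ L) X Δ Δ ≤ quad P (toMat Δ))
    {y : Param m n} (hmin : ∀ z, L y ≤ L z) (x : Param m n) :
    quad P⁻¹ (toMat (gradient L x)) ≤ 2 * (L x - L y) := by
  set G := toMat (gradient L x) with hG
  -- The preconditioned gradient step minimises the quadratic upper model; it lowers L by at least
  -- half of ⟨P⁻¹, G Gᵀ⟩ but cannot go below the minimum.
  have h := le_add_fderiv_add hL hL2 x (-toVec (P⁻¹ * G)) fun z => hbound z _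
  have h1 : fderiv ℝ L x (-toVec (P⁻¹ * G)) = - quad P⁻¹ G := by
    rw [map_neg]
    have : fderiv ℝ L x (toVec (P⁻¹ * G)) = inner ℝ (gradient L x) (toVec (P⁻¹ * G)) := by
      rw [gradient, InnerProductSpace.toDual_symm_apply]
    rw [this, real_inner_comm, inner_eq_trace, toMat_toVec, quad, Matrix.mul_assoc]
  have h2 : quad P (toMat (-toVec (P⁻¹ * G))) = quad P⁻¹ G := by
    have e := quad_sub_smul_inv_mul hP 0 G 1
    have z : quad P (0 : Matrix (Fin m) (Fin n) ℝ) = 0 := by simp [quad]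
    rw [z, one_smul, zero_sub] at e
    simp only [mul_zero, Matrix.mul_zero, one_pow, one_mul, Matrix.transpose_zero, Matrix.trace_zero, sub_zero,
      zero_add] at e
    exact e
  rw [h1, h2] at h
  have := hmin (x + -toVec (P⁻¹ * G))
  linarith

end Smoothness

/-! ### Measurability of the iterates. -/

section Measurability

instance instMeasurableSpaceMatrix {ι κ : Type*} : MeasurableSpace (Matrix ι κ ℝ) :=
  inferInstanceAs (MeasurableSpace (ι → κ → ℝ))

instance instBorelSpaceMatrix {ι κ : Type*} [Countable ι] [Countable κ] :
    BorelSpace (Matrix ι κ ℝ) :=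
  inferInstanceAs (BorelSpace (ι → κ → ℝ))

variable {α : Type*} [MeasurableSpace α] {ι κ l : Type*}

theorem measurable_matrix_iff {M : α → Matrix ι κ ℝ} :
    Measurable M ↔ ∀ i j, Measurable fun a => M a i j := by
  have h : ∀ N : α → ι → κ → ℝ, Measurable N ↔ ∀ i j, Measurable fun a => N a i j := fun N => by
    rw [measurable_pi_iff]
    exact forall_congr' fun i => measurable_pi_iff
  exact h M

theorem measurable_matrix_mul [Fintype κ] {M : α → Matrix ι κ ℝ} {N : α → Matrix κ l ℝ}
    (hM : Measurable M) (hN : Measurable N) : Measurable fun a => M a * N a := by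
  rw [measurable_matrix_iff] at *
  intro i j
  simp only [Matrix.mul_apply]
  exact Finset.measurable_sum _ fun k _ => (hM i k).mul (hN k j)

theorem measurable_matrix_transpose {M : α → Matrix ι κ ℝ} (hM : Measurable M) :
    Measurable fun a => (M a)ᵀ := by
  rw [measurable_matrix_iff] at *
  exact fun i j => hM j i

theorem measurable_matrix_inv [Fintype ι] [DecidableEq ι] {M : α → Matrix ι ι ℝ}
    (hM : Measurable M) : Measurable fun a => (M a)⁻¹ := by
  have h1 : Measurable fun a => (M a).det :=
    (Continuous.matrix_det continuous_id : Continuous fun A : Matrix ι ι ℝ => A.det).measurable.comp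
      hM
  have h2 : Measurable fun a => (M a).adjugate :=
    (Continuous.matrix_adjugate continuous_id :
      Continuous fun A : Matrix ι ι ℝ => A.adjugate).measurable.comp hM
  rw [measurable_matrix_iff] at *
  intro i j
  simp only [Matrix.inv_def, Ring.inverse_eq_inv', Matrix.smul_apply, smul_eq_mul]
  exact h1.inv.mul (h2 i j)

variable {m n : ℕ}

theorem measurable_matSqrt {M : α → Matrix (Fin m) (Fin m) ℝ} (hM : Measurable M)
    (hH : ∀ a, (M a).IsHermitian) : Measurable fun a => matSqrt (M a) := by
  have h := (continuousOn_iff_continuous_domRestrict.mp (continuousOn_matSqrt (m := m))).measurable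
  exact h.comp (hM.subtype_mk (h := hH))

theorem measurable_toMat : Measurable (toMat : Param m n → Matrix (Fin m) (Fin n) ℝ) :=
  measurable_matrix_iff.mpr fun i j => by
    change Measurable fun x : Param m n => x (i, j)
    fun_prop

theorem measurable_toVec : Measurable (toVec : Matrix (Fin m) (Fin n) ℝ → Param m n) := by
  refine (WithLp.measurable_toLp 2 _).comp (measurable_pi_iff.mpr fun p => ?_)
  exact measurable_matrix_iff.mp measurable_id p.1 p.2

theorem measurable_quad {M : α → Matrix (Fin m) (Fin m) ℝ} {X : α → Matrix (Fin m) (Fin n) ℝ}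
    (hM : Measurable M) (hX : Measurable X) : Measurable fun a => quad (M a) (X a) := by
  have h := measurable_matrix_mul hM (measurable_matrix_mul hX (measurable_matrix_transpose hX))
  rw [measurable_matrix_iff] at h
  simp only [quad, Matrix.trace, Matrix.diag]
  exact Finset.measurable_sum _ fun i _ => h i i

/-- A unique minimiser over a compact set depends measurably on a parameter. -/
theorem measurable_of_unique_minimizer {E : Type*} [PseudoMetricSpace E]
    [SecondCountableTopology E] [MeasurableSpace E] [BorelSpace E] {K : Set E} (hK : IsCompact K)
    {f : α → E → ℝ} (hfc : ∀ a, Continuous (f a)) (hfm : ∀ w, Measurable fun a => f a w)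
    {z : α → E} (hzK : ∀ a, z a ∈ K) (hmin : ∀ a, ∀ w ∈ K, f a (z a) ≤ f a w)
    (huniq : ∀ a, ∀ w ∈ K, f a w ≤ f a (z a) → w = z a) : Measurable z := by
  refine measurable_of_isClosed fun C hC => ?_
  obtain ⟨D, hDK, hDc, hDd⟩ :=
    (TopologicalSpace.IsSeparable.of_separableSpace K).exists_countable_dense_subset
  obtain ⟨D', hDK', hDc', hDd'⟩ :=
    (TopologicalSpace.IsSeparable.of_separableSpace (C ∩ K)).exists_countable_dense_subset
  -- The minimiser lies in C exactly when C ∩ K contains approximate minimisers of every precision;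
  -- testing on countable dense subsets keeps this event measurable.
  have e : z ⁻¹' C = ⋂ k : ℕ, ⋃ d ∈ D', ⋂ e ∈ D, {a | f a d ≤ f a e + 1 / ((k : ℝ) + 1)} := by
    ext a
    simp only [Set.mem_preimage, Set.mem_iInter, Set.mem_iUnion, Set.mem_ofPred_eq, exists_prop]
    constructor
    · intro ha k
      have hz : z a ∈ closure D' := hDd' ⟨ha, hzK a⟩
      have ho : IsOpen {w | f a w < f a (z a) + 1 / ((k : ℝ) + 1)} :=
        isOpen_lt (hfc a) continuous_const
      obtain ⟨d, hd1, hd2⟩ := mem_closure_iff.mp hz _ ho (by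
        change f a (z a) < f a (z a) + 1 / ((k : ℝ) + 1)
        have : (0 : ℝ) < 1 / ((k : ℝ) + 1) := by positivity
        linarith)
      refine ⟨d, hd2, fun e he => ?_⟩
      have h1 : f a d < f a (z a) + 1 / ((k : ℝ) + 1) := hd1
      linarith [hmin a e (hDK he)]
    · intro h
      obtain ⟨d0, hd0, -⟩ := h 0
      obtain ⟨w, hw, hwmin⟩ := (hK.inter_left hC).exists_isMinOn ⟨d0, hDK' hd0⟩
        (hfc a).continuousOn
      have h1 : ∀ e ∈ D, f a w ≤ f a e := by
        intro e he
        refine le_of_forall_pos_le_add fun δ hδ => ?_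
        obtain ⟨k, hk⟩ := exists_nat_one_div_lt hδ
        obtain ⟨d, hd, hde⟩ := h k
        have h2 : f a w ≤ f a d := hwmin (hDK' hd)
        linarith [hde e he]
      have h2 : closure D ⊆ {v | f a w ≤ f a v} :=
        closure_minimal h1 (isClosed_le continuous_const (hfc a))
      have h3 := huniq a w hw.2 (h2 (hDd (hzK a)))
      rw [← h3]
      exact hw.1
  rw [e]
  exact MeasurableSet.iInter fun k => MeasurableSet.biUnion hDc' fun d _ =>
    MeasurableSet.biInter hDc fun e _ => measurableSet_le (hfm d) ((hfm e).add_const _)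

theorem continuous_toMat : Continuous (toMat : Param m n → Matrix (Fin m) (Fin n) ℝ) :=
  continuous_matrix fun i j => by
    change Continuous fun x : Param m n => x (i, j)
    fun_prop

theorem continuous_quad_toMat (P : Matrix (Fin m) (Fin m) ℝ) :
    Continuous fun x : Param m n => quad P (toMat x) :=
  (continuous_const.matrix_mul
    (continuous_toMat.matrix_mul continuous_toMat.matrix_transpose)).matrix_trace

/-- Since `𝒳` need not be closed, the projection is viewed on its compact closure: by continuity it
is still a minimiser there, and by the variational inequality the only one. -/
theorem measurable_of_isProjection {𝒳 : Set (Param m n)} (hconv : Convex ℝ 𝒳)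
    (hbdd : Bornology.IsBounded 𝒳) {S : α → Matrix (Fin m) (Fin m) ℝ} (hS : Measurable S)
    (hSp : ∀ a, (S a).PosDef) {y z : α → Param m n} (hy : Measurable y)
    (h : ∀ a, IsProjection (S a ⊗ₖ (1 : Matrix (Fin n) (Fin n) ℝ)) 𝒳 (y a) (z a)) :
    Measurable z := by
  have hfc : ∀ a, Continuous fun w => quad (S a) (toMat (y a - w)) := fun a =>
    (continuous_quad_toMat (S a)).comp (continuous_const.sub continuous_id)
  have hmin : ∀ a, ∀ w ∈ closure 𝒳,
      quad (S a) (toMat (y a - z a)) ≤ quad (S a) (toMat (y a - w)) := fun a =>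
    closure_minimal (fun w hw => (h a).quad_le (hSp a).posSemidef hw)
      (isClosed_le continuous_const (hfc a))
  have hzK : ∀ a, z a ∈ closure 𝒳 := fun a => subset_closure (h a).1
  refine measurable_of_unique_minimizer (f := fun a w => quad (S a) (toMat (y a - w)))
    hbdd.isCompact_closure hfc (fun w => ?_) hzK hmin fun a w hw hle => ?_
  · exact measurable_quad hS (measurable_toMat.comp (hy.sub_const w))
  · by_contra hne
    have h1 := quad_add_quad_le (hSp a).posSemidef hconv.closure (hzK a) (hmin a) hw
    have h2 := quad_pos (hSp a) (sub_ne_zero.mpr (Ne.symm hne))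
    linarith

theorem gradient_apply {f : Param m n → ℝ} (x : Param m n) (p : Fin m × Fin n) :
    gradient f x p = fderiv ℝ f x (EuclideanSpace.single p 1) := by
  have : fderiv ℝ f x (EuclideanSpace.single p 1)
      = inner ℝ (gradient f x) (EuclideanSpace.single p 1) := by
    rw [gradient, InnerProductSpace.toDual_symm_apply]
  rw [this, EuclideanSpace.inner_single_right]
  simp

theorem measurable_uncurry_of_differentiable {F : α → Param m n → ℝ}
    (hF : ∀ x, Measurable fun a => F a x) (hd : ∀ a, Differentiable ℝ (F a)) :
    Measurable fun p : α × Param m n => F p.1 p.2 :=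
  (measurable_uncurry_of_continuous_of_measurable (u := fun x a => F a x)
    (fun a => (hd a).continuous) hF).comp measurable_swap

/-- The gradient of a random differentiable function is jointly measurable. -/
theorem measurable_gradient_uncurry {F : α → Param m n → ℝ}
    (hF : ∀ x, Measurable fun a => F a x) (hd : ∀ a, Differentiable ℝ (F a)) :
    Measurable fun p : α × Param m n => gradient (F p.1) p.2 := by
  have hj := measurable_uncurry_of_differentiable hF hd
  have hcoord : ∀ i : Fin m × Fin n,
      Measurable fun p : α × Param m n => gradient (F p.1) p.2 i := by
    intro i
    refine measurable_of_tendsto_metrizable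
      (f := fun (k : ℕ) (p : α × Param m n) => (k : ℝ) *
        (F p.1 (p.2 + (k : ℝ)⁻¹ • EuclideanSpace.single i 1) - F p.1 p.2)) (fun k => ?_) ?_
    · refine measurable_const.mul (Measurable.sub ?_ hj)
      exact hj.comp (measurable_fst.prodMk (measurable_snd.add_const _))
    · rw [tendsto_pi_nhds]
      intro p
      rw [gradient_apply]
      refine HasFDerivAt.lim (hd p.1 p.2).hasFDerivAt _ ?_
      simpa using tendsto_natCast_atTop_atTop
  exact (WithLp.measurable_toLp 2 _).comp (measurable_pi_iff.mpr hcoord)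

variable {T : ℕ}

/-- The iterates up to step `k` are measurable with respect to the losses before step `k`. -/
theorem measurable_iterate {η ε : ℝ} {𝒳 : Set (Param m n)} (hconv : Convex ℝ 𝒳)
    (hbdd : Bornology.IsBounded 𝒳) {x₁ : Param m n} {ℓ : Fin T → α → Param m n → ℝ}
    {x : Fin T → α → Param m n} (hd : ∀ t a, Differentiable ℝ (ℓ t a))
    (hx : ∀ a, IsOneSidedShampoo η ε 𝒳 x₁ (fun t => ℓ t a) (fun t => x t a)) (k : ℕ)
    (hℓ : ∀ s : Fin T, s.val < k → Measurable (ℓ s)) :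
    ∀ t : Fin T, t.val ≤ k → Measurable (x t) := by
  rintro ⟨j, hj⟩ hjk
  induction j using Nat.strong_induction_on with
  | _ j ih =>
  cases j with
  | zero =>
    have : x ⟨0, hj⟩ = fun _ => x₁ := funext fun a => (hx a).init ⟨0, hj⟩ rfl
    rw [this]
    exact measurable_const
  | succ j =>
    have hj' : j < T := by omega
    have hxm : ∀ s : Fin T, s.val ≤ j → Measurable (x s) := fun s hs =>
      ih s.val (by omega) s.isLt (by simp only at hjk ⊢; omega)
    have hG : ∀ s : Fin T, s.val ≤ j → Measurable fun a => toMat (gradient (ℓ s a) (x s a)) := by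
      intro s hs
      have hm := hℓ s (by simp only at hjk; omega)
      exact measurable_toMat.comp ((measurable_gradient_uncurry
        (fun v => (measurable_pi_iff.mp hm) v) (hd s)).comp (measurable_id.prodMk (hxm s hs)))
    have hA : Measurable fun a =>
        leftAccum ε (fun s => toMat (gradient (ℓ s a) (x s a))) ⟨j, hj'⟩ := by
      rw [measurable_matrix_iff]
      intro p q
      simp only [leftAccum, Matrix.add_apply, Matrix.smul_apply, Matrix.sum_apply, smul_eq_mul]
      refine measurable_const.add (measurable_const.mul (Finset.measurable_sum _ fun s hs => ?_))
      have hs' := hG s (Fin.le_def.mp (Finset.mem_Iic.mp hs))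
      exact measurable_matrix_iff.mp
        (measurable_matrix_mul hs' (measurable_matrix_transpose hs')) p q
    have hpd : ∀ a, (leftAccum ε (fun s => toMat (gradient (ℓ s a) (x s a))) ⟨j, hj'⟩).PosDef :=
      fun a => (hx a).posDef ⟨j, hj'⟩ ⟨j + 1, hj⟩ rfl
    have hS := measurable_matSqrt hA fun a => (hpd a).1
    refine measurable_of_isProjection hconv hbdd hS (fun a => matSqrt_posDef (hpd a)) ?_
      fun a => (hx a).step ⟨j, hj'⟩ ⟨j + 1, hj⟩ rfl
    exact (hxm ⟨j, hj'⟩ le_rfl).sub ((measurable_toVec.comp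
      (measurable_matrix_mul (measurable_matrix_inv hS) (hG ⟨j, hj'⟩ le_rfl))).const_smul η)

end Measurability

/-! ### Differentiating the expectation of random convex functions. -/

section Convex

variable {E : Type*} [NormedAddCommGroup E] [NormedSpace ℝ E]

theorem tendsto_quotient_fderiv {f : E → ℝ} {x : E} (hf : DifferentiableAt ℝ f x) (v : E) :
    Filter.Tendsto (fun k : ℕ => ((k : ℝ) + 1) * (f (x + ((k : ℝ) + 1)⁻¹ • v) - f x))
      Filter.atTop (nhds (fderiv ℝ f x v)) := by
  refine HasFDerivAt.lim hf.hasFDerivAt v (c := fun k : ℕ => (k : ℝ) + 1) ?_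
  refine tendsto_norm_atTop_atTop.comp ?_
  exact Filter.tendsto_atTop_add_const_right _ _ tendsto_natCast_atTop_atTop

theorem quotient_le_of_convexOn {f : E → ℝ} (hf : ConvexOn ℝ Set.univ f) (x v : E) (k : ℕ) :
    ((k : ℝ) + 1) * (f (x + ((k : ℝ) + 1)⁻¹ • v) - f x) ≤ f (x + v) - f x := by
  have hk : (0 : ℝ) < (k : ℝ) + 1 := by positivity
  have hc1 : ((k : ℝ) + 1)⁻¹ ≤ 1 := inv_le_one_of_one_le₀ (by linarith [k.cast_nonneg (α := ℝ)])
  have h := hf.2 (Set.mem_univ x) (Set.mem_univ (x + v)) (sub_nonneg.mpr hc1)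
    (inv_nonneg.mpr hk.le) (sub_add_cancel _ _)
  have e : (1 - ((k : ℝ) + 1)⁻¹) • x + ((k : ℝ) + 1)⁻¹ • (x + v) = x + ((k : ℝ) + 1)⁻¹ • v := by
    module
  rw [e, smul_eq_mul, smul_eq_mul] at h
  have h2 : f (x + ((k : ℝ) + 1)⁻¹ • v) - f x ≤ ((k : ℝ) + 1)⁻¹ * (f (x + v) - f x) := by
    linarith
  calc _ ≤ ((k : ℝ) + 1) * (((k : ℝ) + 1)⁻¹ * (f (x + v) - f x)) :=
        mul_le_mul_of_nonneg_left h2 hk.le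
    _ = _ := by rw [← mul_assoc, mul_inv_cancel₀ hk.ne', one_mul]

theorem fderiv_le_of_convexOn {f : E → ℝ} (hf : ConvexOn ℝ Set.univ f) {x : E}
    (hd : DifferentiableAt ℝ f x) (v : E) : fderiv ℝ f x v ≤ f (x + v) - f x :=
  le_of_tendsto' (tendsto_quotient_fderiv hd v) (quotient_le_of_convexOn hf x v)

/-- Expectation and directional derivative commute for random convex functions, in directions that
point into the set on which the expectation is known. -/
theorem integral_fderiv_eq {Ω : Type*} [MeasurableSpace Ω] {μ : Measure Ω} {f : Ω → E → ℝ}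
    (hf : ∀ ω, ConvexOn ℝ Set.univ (f ω)) (hd : ∀ ω, Differentiable ℝ (f ω)) {𝒳 : Set E}
    (hconv : Convex ℝ 𝒳) {L : E → ℝ} (hL : Differentiable ℝ L)
    (hint : ∀ z ∈ 𝒳, Integrable (fun ω => f ω z) μ) (hmean : ∀ z ∈ 𝒳, ∫ ω, f ω z ∂μ = L z)
    {x y : E} (hx : x ∈ 𝒳) (hy : y ∈ 𝒳)
    (hi : Integrable (fun ω => fderiv ℝ (f ω) x (y - x)) μ) :
    ∫ ω, fderiv ℝ (f ω) x (y - x) ∂μ = fderiv ℝ L x (y - x) := by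
  have hmem : ∀ k : ℕ, x + ((k : ℝ) + 1)⁻¹ • (y - x) ∈ 𝒳 := fun k =>
    hconv.add_smul_sub_mem hx hy ⟨by positivity,
      inv_le_one_of_one_le₀ (by linarith [k.cast_nonneg (α := ℝ)])⟩
  have hqi : ∀ k : ℕ, Integrable (fun ω => ((k : ℝ) + 1) *
      (f ω (x + ((k : ℝ) + 1)⁻¹ • (y - x)) - f ω x)) μ := fun k =>
    ((hint _ (hmem k)).sub (hint x hx)).const_mul _
  have hlim := tendsto_integral_of_dominated_convergence
    (F := fun (k : ℕ) ω => ((k : ℝ) + 1) * (f ω (x + ((k : ℝ) + 1)⁻¹ • (y - x)) - f ω x))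
    (f := fun ω => fderiv ℝ (f ω) x (y - x)) (μ := μ)
    -- By convexity each difference quotient lies between the directional derivative and the full
    -- increment f(y) - f(x), which yields an integrable dominating function.
    (fun ω => |fderiv ℝ (f ω) x (y - x)| + |f ω y - f ω x|)
    (fun k => (hqi k).aestronglyMeasurable) (hi.abs.add ((hint y hy).sub (hint x hx)).abs)
    (fun k => Filter.Eventually.of_forall fun ω => ?_)
    (Filter.Eventually.of_forall fun ω => tendsto_quotient_fderiv (hd ω x) _)
  · refine tendsto_nhds_unique hlim ?_
    refine (tendsto_quotient_fderiv (hL x) (y - x)).congr fun k => ?_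
    rw [integral_const_mul, integral_sub (hint _ (hmem k)) (hint x hx), hmean _ (hmem k),
      hmean x hx]
  · have h1 := quotient_le_of_convexOn (hf ω) x (y - x) k
    rw [add_sub_cancel] at h1
    have hk : (0 : ℝ) < (k : ℝ) + 1 := by positivity
    have h2 := fderiv_le_of_convexOn (hf ω) (hd ω x) (((k : ℝ) + 1)⁻¹ • (y - x))
    rw [map_smul, smul_eq_mul, inv_mul_le_iff₀ hk] at h2
    rw [Real.norm_eq_abs, abs_le]
    constructor
    · linarith [neg_abs_le (fderiv ℝ (f ω) x (y - x)), abs_nonneg (f ω y - f ω x)]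
    · linarith [le_abs_self (f ω y - f ω x), abs_nonneg (fderiv ℝ (f ω) x (y - x))]

end Convex

/-! ### Fubini for independent variables. -/

section Independence

variable {Ω : Type*} [MeasurableSpace Ω] {μ : Measure Ω} [IsProbabilityMeasure μ]
  {α β : Type*} [MeasurableSpace α] [MeasurableSpace β] {U : Ω → α} {X : Ω → β}

/-- Independence lets U and X be sampled from separate copies of Ω; freezing the copy used for X
plays the role of conditioning on it. -/
theorem map_prodMk_eq_of_indepFun (hU : Measurable U) (hX : Measurable X) (h : IndepFun U X μ) :
    μ.map (fun ω => (U ω, X ω)) = (μ.prod μ).map (Prod.map U X) := by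
  rw [(indepFun_iff_map_prod_eq_prod_map_map hU.aemeasurable hX.aemeasurable).mp h,
    Measure.map_prod_map _ _ hU hX]

theorem lintegral_eq_of_indepFun (hU : Measurable U) (hX : Measurable X) (h : IndepFun U X μ)
    {φ : α × β → ENNReal} (hφ : Measurable φ) :
    ∫⁻ ω, φ (U ω, X ω) ∂μ = ∫⁻ ω', ∫⁻ ω, φ (U ω, X ω') ∂μ ∂μ := by
  rw [← lintegral_map hφ (hU.prodMk hX), map_prodMk_eq_of_indepFun hU hX h,
    lintegral_map hφ (hU.prodMap hX),
    lintegral_prod_symm' (fun p => φ (Prod.map U X p)) (hφ.comp (hU.prodMap hX))]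
  rfl

theorem integral_eq_of_indepFun (hU : Measurable U) (hX : Measurable X) (h : IndepFun U X μ)
    {φ : α × β → ℝ} (hφ : Measurable φ) (hi : Integrable (fun ω => φ (U ω, X ω)) μ) :
    ∫ ω, φ (U ω, X ω) ∂μ = ∫ ω', ∫ ω, φ (U ω, X ω') ∂μ ∂μ := by
  have hi' : Integrable (fun p => φ (Prod.map U X p)) (μ.prod μ) := by
    rw [show (fun p => φ (Prod.map U X p)) = φ ∘ Prod.map U X from rfl,
      ← integrable_map_measure hφ.aestronglyMeasurable (hU.prodMap hX).aemeasurable,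
      ← map_prodMk_eq_of_indepFun hU hX h,
      integrable_map_measure hφ.aestronglyMeasurable (hU.prodMk hX).aemeasurable]
    exact hi
  rw [← integral_map (hU.prodMk hX).aemeasurable hφ.aestronglyMeasurable,
    map_prodMk_eq_of_indepFun hU hX h,
    integral_map (hU.prodMap hX).aemeasurable hφ.aestronglyMeasurable,
    integral_prod_symm _ hi']
  rfl

theorem memLp_comp_of_indepFun {E : Type*} [NormedAddCommGroup E] [MeasurableSpace E]
    [BorelSpace E] [SecondCountableTopology E] (hU : Measurable U) (hX : Measurable X)
    (h : IndepFun U X μ) {φ : α × β → E} (hφ : Measurable φ) {C : ℝ}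
    (hL : ∀ ω', MemLp (fun ω => φ (U ω, X ω')) 2 μ)
    (hC : ∀ ω', ∫ ω, ‖φ (U ω, X ω')‖ ^ 2 ∂μ ≤ C) :
    MemLp (fun ω => φ (U ω, X ω)) 2 μ := by
  have hm : Measurable fun ω => φ (U ω, X ω) := hφ.comp (hU.prodMk hX)
  rw [memLp_two_iff_integrable_sq_norm hm.aestronglyMeasurable]
  refine ⟨(hm.norm.pow_const 2).aestronglyMeasurable, ?_⟩
  have e : ∀ p, ‖‖φ p‖ ^ 2‖ₑ = ENNReal.ofReal (‖φ p‖ ^ 2) := fun p =>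
    Real.enorm_of_nonneg (by positivity)
  have hle := lintegral_eq_of_indepFun hU hX h
    (φ := fun p => ENNReal.ofReal (‖φ p‖ ^ 2)) (hφ.norm.pow_const 2).ennreal_ofReal
  simp only [HasFiniteIntegral, e]
  rw [hle]
  refine lt_of_le_of_lt (lintegral_mono (g := fun _ => ENNReal.ofReal C) fun ω' => ?_) (by simp)
  rw [← ofReal_integral_eq_lintegral_ofReal
    ((memLp_two_iff_integrable_sq_norm (hL ω').1).mp (hL ω'))
    (Filter.Eventually.of_forall fun ω => by positivity)]
  exact ENNReal.ofReal_le_ofReal (hC ω')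

end Independence

/-! ### Gradient noise at fixed and at random points. -/

section Noise

variable {Ω : Type*} [MeasurableSpace Ω] {μ : Measure Ω} {m n T : ℕ}

theorem memLp_coord {g : Ω → Param m n} (hg : MemLp g 2 μ) (p : Fin m × Fin n) :
    MemLp (fun ω => g ω p) 2 μ :=
  (EuclideanSpace.proj (𝕜 := ℝ) p).comp_memLp' hg

theorem integrable_coord_mul {g h : Ω → Param m n} (hg : MemLp g 2 μ) (hh : MemLp h 2 μ)
    (p q : Fin m × Fin n) : Integrable (fun ω => g ω p * h ω q) μ :=
  (memLp_coord hg p).integrable_mul (memLp_coord hh q)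

theorem integrable_inner_of_memLp {g h : Ω → Param m n} (hg : MemLp g 2 μ) (hh : MemLp h 2 μ) :
    Integrable (fun ω => inner ℝ (g ω) (h ω)) μ := by
  simp only [PiLp.inner_apply]
  exact integrable_finsetSum _ fun p _ => integrable_coord_mul hh hg p p

theorem quad_toMat_eq_sum (P : Matrix (Fin m) (Fin m) ℝ) (x : Param m n) :
    quad P (toMat x)
      = ∑ p, ∑ q, (P ⊗ₖ (1 : Matrix (Fin n) (Fin n) ℝ)) p q * (x p * x q) := by
  rw [quad, ← dotProduct_kronecker_one_mulVec]
  simp only [dotProduct, Matrix.mulVec, Finset.mul_sum]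
  exact Finset.sum_congr rfl fun p _ => Finset.sum_congr rfl fun q _ => by ring

theorem integrable_quad_of_memLp (P : Matrix (Fin m) (Fin m) ℝ) {g : Ω → Param m n}
    (hg : MemLp g 2 μ) : Integrable (fun ω => quad P (toMat (g ω))) μ := by
  simp only [quad_toMat_eq_sum]
  exact integrable_finsetSum _ fun p _ => integrable_finsetSum _ fun q _ =>
    (integrable_coord_mul hg hg p q).const_mul _

theorem integral_sum_sum_mul {g : Ω → Param m n} (hg : MemLp g 2 μ)
    (K : Matrix (Fin m × Fin n) (Fin m × Fin n) ℝ) :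
    ∫ ω, ∑ p, ∑ q, K p q * (g ω p * g ω q) ∂μ
      = ((Matrix.of fun p q => ∫ ω, g ω p * g ω q ∂μ) * K).trace := by
  have hi : ∀ p q, Integrable (fun ω => K p q * (g ω p * g ω q)) μ := fun p q =>
    (integrable_coord_mul hg hg p q).const_mul _
  have e : ∫ ω, ∑ p, ∑ q, K p q * (g ω p * g ω q) ∂μ
      = ∑ p, ∑ q, K p q * ∫ ω, g ω p * g ω q ∂μ := by
    refine (integral_finsetSum _ fun p _ => integrable_finsetSum _ fun q _ => hi p q).trans ?_
    refine Finset.sum_congr rfl fun p _ => ?_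
    refine (integral_finsetSum _ fun q _ => hi p q).trans ?_
    exact Finset.sum_congr rfl fun q _ => integral_const_mul _ _
  rw [e, Matrix.trace_mul_comm]
  simp only [Matrix.trace, Matrix.diag, Matrix.mul_apply, Matrix.of_apply]
  refine Finset.sum_congr rfl fun p _ => Finset.sum_congr rfl fun q _ => ?_
  simp only [mul_comm]

theorem integral_quad_le (S : Matrix (Fin m × Fin n) (Fin m × Fin n) ℝ) {g : Ω → Param m n}
    (hg : MemLp g 2 μ)
    (hS : (S - Matrix.of fun p q => ∫ ω, g ω p * g ω q ∂μ).PosSemidef)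
    {P : Matrix (Fin m) (Fin m) ℝ} (hP : P.PosSemidef) :
    ∫ ω, quad P (toMat (g ω)) ∂μ
      ≤ (S * (P ⊗ₖ (1 : Matrix (Fin n) (Fin n) ℝ))).trace := by
  refine le_trans (le_of_eq ?_)
    (trace_mul_le_trace_mul hS (hP.kronecker (Matrix.PosSemidef.one)))
  simp only [quad_toMat_eq_sum]
  exact integral_sum_sum_mul hg _

theorem quad_one_toMat (x : Param m n) : quad 1 (toMat x) = ‖x‖ ^ 2 := by
  rw [quad, Matrix.one_mul, ← inner_eq_trace, real_inner_self_eq_norm_sq]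

theorem fderiv_eq_inner_gradient (f : Param m n → ℝ) (x v : Param m n) :
    fderiv ℝ f x v = inner ℝ (gradient f x) v := by
  rw [gradient, InnerProductSpace.toDual_symm_apply]

theorem continuous_gradient {L : Param m n → ℝ} (h : Continuous (fderiv ℝ L)) :
    Continuous (gradient L) :=
  (InnerProductSpace.toDual ℝ (Param m n)).symm.continuous.comp h

variable {𝒳 : Set (Param m n)} {ℓ : Fin T → Ω → Param m n → ℝ}
  {L : Param m n → ℝ} {S : Matrix (Fin m × Fin n) (Fin m × Fin n) ℝ}

/-- The gradient noise has mean zero on the domain. -/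
theorem NoiseAssumption.integral_noise_eq_zero [IsProbabilityMeasure μ] (hnoise : NoiseAssumption μ 𝒳 ℓ L S)
    (hconv : Convex ℝ 𝒳) (hℓconv : ∀ t ω, ConvexOn ℝ Set.univ (ℓ t ω))
    (hℓdiff : ∀ t ω, Differentiable ℝ (ℓ t ω)) (hL : Differentiable ℝ L)
    (hgrad : interior 𝒳 = ∅ → ∀ t, ∀ x ∈ 𝒳, ∫ ω, gradient (ℓ t ω) x ∂μ = gradient L x)
    (t : Fin T) {x : Param m n} (hx : x ∈ 𝒳) :
    ∫ ω, (gradient (ℓ t ω) x - gradient L x) ∂μ = 0 := by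
  have hN : Integrable (fun ω => gradient (ℓ t ω) x - gradient L x) μ :=
    (hnoise.secondMoment t x hx).integrable (by norm_num)
  have hG : Integrable (fun ω => gradient (ℓ t ω) x) μ := by
    exact (hN.add (integrable_const (gradient L x))).congr
      (Filter.Eventually.of_forall fun ω => sub_add_cancel _ _)
  rcases Set.eq_empty_or_nonempty (interior 𝒳) with h0 | ⟨z, hz⟩
  · rw [integral_sub hG (integrable_const _), hgrad h0 t x hx]
    simp
  · set e := ∫ ω, (gradient (ℓ t ω) x - gradient L x) ∂μ with he
    -- The mean noise e is orthogonal to all directions pointing into `𝒳`. Comparing an interior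
    -- point z with z + s e then gives s |e|² = 0.
    have key : ∀ y ∈ 𝒳, inner ℝ e (y - x) = 0 := by
      intro y hy
      have hfi : Integrable (fun ω => fderiv ℝ (ℓ t ω) x (y - x)) μ := by
        simp only [fderiv_eq_inner_gradient]
        exact hG.inner_const _
      have h1 := integral_fderiv_eq (hℓconv t) (hℓdiff t) hconv hL (hnoise.integrable t)
        (hnoise.mean t) hx hy hfi
      rw [real_inner_comm, he, ← integral_inner hN]
      simp only [inner_sub_right]
      have h2 : ∀ ω, inner ℝ (y - x) (gradient (ℓ t ω) x) = fderiv ℝ (ℓ t ω) x (y - x) :=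
        fun ω => by rw [real_inner_comm, fderiv_eq_inner_gradient]
      simp only [h2]
      rw [integral_sub hfi (integrable_const _), h1, fderiv_eq_inner_gradient, real_inner_comm]
      simp
    obtain ⟨r, hr, hball⟩ := Metric.isOpen_iff.mp isOpen_interior z hz
    set s : ℝ := r / (2 * (‖e‖ + 1)) with hs
    have hs0 : 0 < s := by positivity
    have hmem : z + s • e ∈ 𝒳 := by
      refine interior_subset (hball ?_)
      rw [Metric.mem_ball, dist_eq_norm, add_sub_cancel_left, norm_smul, Real.norm_of_nonneg hs0.le,
        hs, div_mul_eq_mul_div, div_lt_iff₀ (by positivity)]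
      nlinarith [norm_nonneg e]
    have h1 := key _ (interior_subset hz)
    have h2 := key _ hmem
    rw [add_sub_right_comm, inner_add_right, h1, zero_add, inner_smul_right] at h2
    exact inner_self_eq_zero.mp ((mul_eq_zero.mp h2).resolve_left hs0.ne')

variable {t : Fin T} {X : Ω → Param m n}

/-- Joint measurability of the gradient in function and point is obtained on the subtype of
differentiable functions. Passing to it leaves the σ-algebra generated by the loss unchanged. -/
theorem indepFun_subtype (hd : ∀ ω, Differentiable ℝ (ℓ t ω))
    (h : IndepFun (ℓ t) X μ) :
    IndepFun (fun ω => (⟨ℓ t ω, hd ω⟩ : {f : Param m n → ℝ // Differentiable ℝ f})) X μ := by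
  rw [IndepFun_iff_Indep] at h ⊢
  change Indep (MeasurableSpace.comap _ (MeasurableSpace.comap Subtype.val _)) _ μ
  rw [MeasurableSpace.comap_comp]
  exact h

theorem measurable_noise_uncurry (hLc : Continuous (gradient L)) :
    Measurable fun p : {f : Param m n → ℝ // Differentiable ℝ f} × Param m n =>
      gradient p.1.val p.2 - gradient L p.2 :=
  (measurable_gradient_uncurry (F := fun f : {f : Param m n → ℝ // Differentiable ℝ f} => f.val)
    (fun x => (measurable_pi_apply x).comp measurable_subtype_coe) fun f => f.property).sub
    (hLc.measurable.comp measurable_snd)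

/-- The gradient noise at an independent random point of the domain is square integrable. -/
theorem NoiseAssumption.memLp_noise_comp [IsProbabilityMeasure μ] (hnoise : NoiseAssumption μ 𝒳 ℓ L S)
    (hLc : Continuous (gradient L)) (hd : ∀ ω, Differentiable ℝ (ℓ t ω))
    (hℓm : Measurable (ℓ t)) (hXm : Measurable X) (hX : ∀ ω, X ω ∈ 𝒳) (hi : IndepFun (ℓ t) X μ) :
    MemLp (fun ω => gradient (ℓ t ω) (X ω) - gradient L (X ω)) 2 μ := by
  refine memLp_comp_of_indepFun
    (U := fun ω => (⟨ℓ t ω, hd ω⟩ : {f : Param m n → ℝ // Differentiable ℝ f}))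
    hℓm.subtype_mk hXm (indepFun_subtype hd hi) (measurable_noise_uncurry hLc)
    -- The choice P = 1 turns the quadratic form into the squared norm, so this C bounds the second
    -- moment uniformly over `𝒳`.
    (C := (S * ((1 : Matrix (Fin m) (Fin m) ℝ) ⊗ₖ (1 : Matrix (Fin n) (Fin n) ℝ))).trace)
    (fun ω' => hnoise.secondMoment t _ (hX ω')) fun ω' => ?_
  have h3 := integral_quad_le S (hnoise.secondMoment t _ (hX ω')) (hnoise.bound t _ (hX ω'))
    Matrix.PosSemidef.one
  simp only [quad_one_toMat] at h3
  exact h3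

theorem memLp_of_bounded [IsProbabilityMeasure μ] {g : Ω → Param m n} (hg : Measurable g) {C : ℝ} (hC : ∀ ω, ‖g ω‖ ≤ C) :
    MemLp g 2 μ :=
  MemLp.of_bound hg.aestronglyMeasurable C (Filter.Eventually.of_forall hC)

theorem NoiseAssumption.integral_inner_noise_comp [IsProbabilityMeasure μ] (hnoise : NoiseAssumption μ 𝒳 ℓ L S)
    (hmean : ∀ x ∈ 𝒳, ∫ ω, (gradient (ℓ t ω) x - gradient L x) ∂μ = 0)
    (hLc : Continuous (gradient L)) (hd : ∀ ω, Differentiable ℝ (ℓ t ω))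
    (hℓm : Measurable (ℓ t)) (hXm : Measurable X) (hX : ∀ ω, X ω ∈ 𝒳) (hi : IndepFun (ℓ t) X μ)
    {v : Param m n → Param m n} (hv : Measurable v) {C : ℝ} (hC : ∀ x ∈ 𝒳, ‖v x‖ ≤ C) :
    ∫ ω, inner ℝ (gradient (ℓ t ω) (X ω) - gradient L (X ω)) (v (X ω)) ∂μ = 0 := by
  have hUm : Measurable (fun ω => (⟨ℓ t ω, hd ω⟩ : {f : Param m n → ℝ // Differentiable ℝ f})) :=
    hℓm.subtype_mk
  have hint := integrable_inner_of_memLp (hnoise.memLp_noise_comp hLc hd hℓm hXm hX hi)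
    (memLp_of_bounded (hv.comp hXm) fun ω => hC _ (hX ω))
  have h := integral_eq_of_indepFun hUm hXm (indepFun_subtype hd hi)
    (φ := fun p => inner ℝ (gradient p.1.val p.2 - gradient L p.2) (v p.2))
    ((measurable_noise_uncurry hLc).inner (hv.comp measurable_snd)) hint
  refine h.trans ?_
  have h0 : ∀ ω', ∫ ω, inner ℝ (gradient (ℓ t ω) (X ω') - gradient L (X ω')) (v (X ω')) ∂μ = 0 := by
    intro ω'
    simp only [real_inner_comm (v (X ω'))]
    rw [integral_inner ((hnoise.secondMoment t _ (hX ω')).integrable (by norm_num)),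
      hmean _ (hX ω'), inner_zero_right]
  exact (integral_congr_ae (Filter.Eventually.of_forall h0)).trans (by simp)

theorem NoiseAssumption.integral_quad_noise_comp_le [IsProbabilityMeasure μ] (hnoise : NoiseAssumption μ 𝒳 ℓ L S)
    (hLc : Continuous (gradient L)) (hd : ∀ ω, Differentiable ℝ (ℓ t ω))
    (hℓm : Measurable (ℓ t)) (hXm : Measurable X) (hX : ∀ ω, X ω ∈ 𝒳) (hi : IndepFun (ℓ t) X μ)
    {P : Matrix (Fin m) (Fin m) ℝ} (hP : P.PosSemidef) :
    ∫ ω, quad P (toMat (gradient (ℓ t ω) (X ω) - gradient L (X ω))) ∂μ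
      ≤ (S * (P ⊗ₖ (1 : Matrix (Fin n) (Fin n) ℝ))).trace := by
  have hUm : Measurable (fun ω => (⟨ℓ t ω, hd ω⟩ : {f : Param m n → ℝ // Differentiable ℝ f})) :=
    hℓm.subtype_mk
  have h := integral_eq_of_indepFun hUm hXm (indepFun_subtype hd hi)
    (φ := fun p => quad P (toMat (gradient p.1.val p.2 - gradient L p.2)))
    ((continuous_quad_toMat P).measurable.comp (measurable_noise_uncurry hLc))
    (integrable_quad_of_memLp P (hnoise.memLp_noise_comp hLc hd hℓm hXm hX hi))
  refine h.le.trans ?_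
  have hb : ∀ ω', ∫ ω, quad P (toMat (gradient (ℓ t ω) (X ω') - gradient L (X ω'))) ∂μ
      ≤ (S * (P ⊗ₖ (1 : Matrix (Fin n) (Fin n) ℝ))).trace := fun ω' =>
    integral_quad_le S (hnoise.secondMoment t _ (hX ω')) (hnoise.bound t _ (hX ω')) hP
  have h0 : ∀ ω', 0 ≤ ∫ ω, quad P (toMat (gradient (ℓ t ω) (X ω') - gradient L (X ω'))) ∂μ :=
    fun ω' => integral_nonneg fun ω => quad_nonneg hP _
  refine (integral_mono_of_nonneg (Filter.Eventually.of_forall h0) (integrable_const _)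
    (Filter.Eventually.of_forall hb)).trans ?_
  simp

/-- The measurability of the iterates is applied with the σ-algebra generated by the losses before
step t only, which is independent of the t-th loss. -/
theorem indepFun_iterate {η ε : ℝ} (hconv : Convex ℝ 𝒳)
    (hbdd : Bornology.IsBounded 𝒳) {x₁ : Param m n}
    {x : Fin T → Ω → Param m n} (hℓmeas : ∀ t, Measurable (ℓ t)) (hℓindep : iIndepFun ℓ μ)
    (hd : ∀ t ω, Differentiable ℝ (ℓ t ω))
    (hx : ∀ ω, IsOneSidedShampoo η ε 𝒳 x₁ (fun t => ℓ t ω) (fun t => x t ω)) (t : Fin T) :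
    IndepFun (ℓ t) (x t) μ := by
  have hind := indep_iSup_of_disjoint (fun s => (hℓmeas s).comap_le) hℓindep
    (S := {t}) (T := {s | s.val < t.val}) (by simp)
  rw [IndepFun_iff_Indep]
  refine indep_of_indep_of_le_left (indep_of_indep_of_le_right hind ?_) ?_
  · have := @measurable_iterate Ω (⨆ s ∈ {s : Fin T | s.val < t.val},
      MeasurableSpace.comap (ℓ s) MeasurableSpace.pi) m n T η ε 𝒳 hconv hbdd x₁ ℓ x hd hx t.val
      (fun s hs => Measurable.of_comap_le
        (le_iSup₂_of_le (f := fun s (_ : s ∈ {s : Fin T | s.val < t.val}) =>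
          MeasurableSpace.comap (ℓ s) MeasurableSpace.pi) s hs le_rfl)) t le_rfl
    exact this.comap_le
  · exact le_iSup₂_of_le (f := fun s (_ : s ∈ ({t} : Set (Fin T))) =>
          MeasurableSpace.comap (ℓ s) MeasurableSpace.pi) t rfl le_rfl

end Noise

/-! ### Size of the domain and the tuned regret bound. -/

section Domain

variable {m n : ℕ} {𝒳 : Set (Param m n)}

theorem exists_norm_le_of_continuous {F : Type*} [SeminormedAddCommGroup F]
    (hbdd : Bornology.IsBounded 𝒳) {f : Param m n → F} (hf : Continuous f) :
    ∃ C, ∀ z ∈ 𝒳, ‖f z‖ ≤ C := by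
  obtain ⟨C, hC⟩ := hbdd.isCompact_closure.exists_bound_of_continuousOn hf.continuousOn
  exact ⟨C, fun z hz => hC z (subset_closure hz)⟩

theorem opNorm_le_setOpNorm (hbdd : Bornology.IsBounded 𝒳) {x : Param m n} (hx : x ∈ 𝒳) :
    opNorm (toMat x) ≤ setOpNorm 𝒳 := by
  obtain ⟨C, hC⟩ := exists_norm_le_of_continuous hbdd continuous_opNorm_toMat
  refine le_csSup ⟨C, ?_⟩ ⟨x, hx, rfl⟩
  rintro _ ⟨y, hy, rfl⟩
  exact (le_abs_self _).trans (hC y hy)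

theorem opNorm_toMat_sub_le (hbdd : Bornology.IsBounded 𝒳) {x y : Param m n} (hx : x ∈ 𝒳)
    (hy : y ∈ 𝒳) : opNorm (toMat (x - y)) ≤ 2 * setOpNorm 𝒳 := by
  rw [toMat_sub]
  linarith [opNorm_sub_le (toMat x) (toMat y), opNorm_le_setOpNorm hbdd hx,
    opNorm_le_setOpNorm hbdd hy]

theorem setOpNorm_nonneg (hbdd : Bornology.IsBounded 𝒳) {x : Param m n} (hx : x ∈ 𝒳) :
    0 ≤ setOpNorm 𝒳 :=
  (opNorm_nonneg _).trans (opNorm_le_setOpNorm hbdd hx)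

theorem eq_of_setOpNorm_eq_zero (hbdd : Bornology.IsBounded 𝒳) (h0 : setOpNorm 𝒳 = 0)
    {x y : Param m n} (hx : x ∈ 𝒳) (hy : y ∈ 𝒳) : x = y := by
  have h := quad_le_of_opNorm_le Matrix.PosSemidef.one (opNorm_toMat_sub_le hbdd hx hy)
  rw [h0, quad_one_toMat] at h
  have h1 : ‖x - y‖ ^ 2 ≤ 0 := by simpa using h
  exact sub_eq_zero.mp (norm_eq_zero.mp (pow_eq_zero_iff two_ne_zero |>.mp
    (le_antisymm h1 (by positivity))))

variable {T : ℕ}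

/-- The regret of one-sided Shampoo with the tuned learning rate, in variational form. -/
theorem IsOneSidedShampoo.regret_le_variational {ε : ℝ} {x₁ : Param m n}
    {ℓ : Fin T → Param m n → ℝ} {x : Fin T → Param m n}
    (h : IsOneSidedShampoo (Real.sqrt (2 / n) * setOpNorm 𝒳) ε 𝒳 x₁ ℓ x) (hx₁ : x₁ ∈ 𝒳)
    (hconv : Convex ℝ 𝒳) (hbdd : Bornology.IsBounded 𝒳)
    (hn : 0 < n) (hT : 0 < T) (hε : 0 ≤ ε) {w : Param m n} (hw : w ∈ 𝒳)
    {P : Matrix (Fin m) (Fin m) ℝ} (hP : P.PosDef) :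
    ∑ t, inner ℝ (gradient (ℓ t) (x t)) (x t - w)
      ≤ Real.sqrt 2 * Real.sqrt n * setOpNorm 𝒳 * (ε * P⁻¹.trace
        + 1 / n * ∑ t, quad P⁻¹ (toMat (gradient (ℓ t) (x t))) + P.trace) := by
  have hn' : (0 : ℝ) < n := by exact_mod_cast hn
  have hsn0 : 0 < Real.sqrt n := Real.sqrt_pos.mpr hn'
  have hs20 : 0 < Real.sqrt 2 := Real.sqrt_pos.mpr two_pos
  set R := setOpNorm 𝒳 with hR
  have hR0 : 0 ≤ R := setOpNorm_nonneg hbdd hw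
  -- If R = 0 the domain is a single point and the regret vanishes; otherwise one may divide by the
  -- learning rate.
  rcases hR0.eq_or_lt with h0 | hpos
  · have : ∀ t, x t - w = 0 := fun t =>
      sub_eq_zero.mpr (eq_of_setOpNorm_eq_zero hbdd h0.symm (h.mem hx₁ t) hw)
    simp [this, ← h0]
  · have hreg := h.regret_le hx₁ hconv hn hT hε hw
      (fun z hz => opNorm_toMat_sub_le hbdd hz hw)
    have hvar := two_mul_trace_le hP (matSqrt_posSemidef
      (accum ε (fun s => toMat (gradient (ℓ s) (x s))) T))
    rw [matSqrt_mul_self (accum_posSemidef hε _ _)] at hvar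
    set τ := (matSqrt (accum ε (fun s => toMat (gradient (ℓ s) (x s))) T)).trace
    have hacc : (P⁻¹ * accum ε (fun s => toMat (gradient (ℓ s) (x s))) T).trace
        = ε * P⁻¹.trace + 1 / n * ∑ t, quad P⁻¹ (toMat (gradient (ℓ t) (x t))) := by
      rw [accum_top]
      simp [Matrix.mul_add, Matrix.trace_add, Matrix.mul_sum, Matrix.trace_sum, quad]
    rw [hacc] at hvar
    rw [← hR, mul_pow (Real.sqrt (2 / n)) R, Real.sq_sqrt (by positivity), Real.sqrt_div (by norm_num)] at hreg
    set Q := ∑ t, inner ℝ (gradient (ℓ t) (x t)) (x t - w)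
    -- The learning rate makes the change-of-norm cost and the gradient cost equal, 4R² each.
    have e : (2 * R) ^ 2 + 2 * n * (2 / n * R ^ 2) = 8 * R ^ 2 := by
      field_simp; ring
    rw [e] at hreg
    have e2 : Q = Real.sqrt n / (2 * Real.sqrt 2 * R)
        * (2 * (Real.sqrt 2 / Real.sqrt n * R) * Q) := by
      field_simp
    have h3 : Q ≤ Real.sqrt n / (2 * Real.sqrt 2 * R) * (8 * R ^ 2 * τ) := by
      rw [e2]
      exact mul_le_mul_of_nonneg_left hreg (by positivity)
    have e3 : Real.sqrt n / (2 * Real.sqrt 2 * R) * (8 * R ^ 2 * τ)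
        = Real.sqrt 2 * Real.sqrt n * R * (2 * τ) := by
      field_simp
      rw [Real.sq_sqrt (by norm_num)]
      ring
    rw [e3] at h3
    exact h3.trans (mul_le_mul_of_nonneg_left hvar (by positivity))

end Domain

/-! ### The set of preconditioners defining the noise level. -/

section Preconditioner

variable {m n : ℕ}

theorem posDef_of_kronecker_one (hn : 0 < n) {A : Matrix (Fin m) (Fin m) ℝ} (hA : A.PosSemidef)
    (h : (A ⊗ₖ (1 : Matrix (Fin n) (Fin n) ℝ)).PosDef) : A.PosDef := by
  rw [hA.posDef_iff_det_ne_zero]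
  intro h0
  have := h.det_pos
  rw [Matrix.det_kronecker, h0] at this
  simp [hn.ne'] at this

theorem inv_kronecker_one (A : Matrix (Fin m) (Fin m) ℝ) :
    (A ⊗ₖ (1 : Matrix (Fin n) (Fin n) ℝ))⁻¹ = A⁻¹ ⊗ₖ (1 : Matrix (Fin n) (Fin n) ℝ) := by
  rw [Matrix.inv_kronecker, inv_one]

theorem inv_smul_posDef {ι : Type*} [Fintype ι] [DecidableEq ι] {A : Matrix ι ι ℝ} (hA : A.PosDef)
    {c : ℝ} (hc : 0 < c) : (c • A)⁻¹ = c⁻¹ • A⁻¹ := by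
  have hu : IsUnit A.det := (Matrix.isUnit_iff_isUnit_det _).mp hA.isUnit
  refine Matrix.inv_eq_right_inv ?_
  rw [Matrix.smul_mul, Matrix.mul_smul, smul_smul, mul_inv_cancel₀ hc.ne', one_smul,
    Matrix.mul_nonsing_inv _ hu]

theorem trace_mul_kronecker_one_mono {S : Matrix (Fin m × Fin n) (Fin m × Fin n) ℝ}
    (hS : S.PosSemidef) {A B : Matrix (Fin m) (Fin m) ℝ} (h : (B - A).PosSemidef) :
    (S * (A ⊗ₖ (1 : Matrix (Fin n) (Fin n) ℝ))).trace
      ≤ (S * (B ⊗ₖ (1 : Matrix (Fin n) (Fin n) ℝ))).trace := by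
  rw [Matrix.trace_mul_comm S, Matrix.trace_mul_comm S]
  refine trace_mul_le_trace_mul ?_ hS
  have h1 := h.kronecker (Matrix.PosSemidef.one (n := Fin n) (R := ℝ))
  have h2 : (B - A) ⊗ₖ (1 : Matrix (Fin n) (Fin n) ℝ) = B ⊗ₖ 1 - A ⊗ₖ 1 := by
    ext p q
    simp [Matrix.kroneckerMap_apply, sub_mul]
  rwa [h2] at h1

/-- The members of the set defining the noise level, in terms of the left factor. -/
theorem exists_posDef_of_mem_noiseLevelSet (hn : 0 < n)
    {S : Matrix (Fin m × Fin n) (Fin m × Fin n) ℝ} (hS : S.PosSemidef) {s : ℝ}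
    (hs : s ∈ {s | ∃ H ∈ preconditioners m n, H.PosDef ∧ H.trace ≤ 1 ∧
      s = Real.sqrt ((Sᵀ * H⁻¹).trace)}) :
    ∃ A : Matrix (Fin m) (Fin m) ℝ, A.PosDef ∧ n * A.trace ≤ 1 ∧ 0 ≤ s ∧
      (S * (A⁻¹ ⊗ₖ (1 : Matrix (Fin n) (Fin n) ℝ))).trace = s ^ 2 := by
  obtain ⟨_, ⟨A, hA, rfl⟩, hpd, htr, rfl⟩ := hs
  refine ⟨A, posDef_of_kronecker_one hn hA hpd, ?_, Real.sqrt_nonneg _, ?_⟩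
  · rw [Matrix.trace_kronecker, Matrix.trace_one, Fintype.card_fin] at htr
    linarith
  · rw [transpose_eq_of_isHermitian hS.1,
      Real.sq_sqrt (trace_mul_nonneg hS hpd.inv.posSemidef), inv_kronecker_one]

theorem noiseLevelSet_nonempty (hm : 0 < m) (hn : 0 < n)
    (S : Matrix (Fin m × Fin n) (Fin m × Fin n) ℝ) :
    {s | ∃ H ∈ preconditioners m n, H.PosDef ∧ H.trace ≤ 1 ∧
      s = Real.sqrt ((Sᵀ * H⁻¹).trace)}.Nonempty := by
  have hm' : (0 : ℝ) < m := by exact_mod_cast hm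
  have hn' : (0 : ℝ) < n := by exact_mod_cast hn
  have hpd : (((m : ℝ) * n)⁻¹ • (1 : Matrix (Fin m) (Fin m) ℝ)).PosDef :=
    Matrix.PosDef.one.smul (by positivity)
  refine ⟨_, _, ⟨_, hpd.posSemidef, rfl⟩, hpd.kronecker Matrix.PosDef.one, ?_, rfl⟩
  rw [Matrix.trace_kronecker, Matrix.trace_smul, Matrix.trace_one, Matrix.trace_one]
  simp only [Fintype.card_fin, smul_eq_mul]
  exact le_of_eq (by field_simp)

theorem le_mul_sInf_add {A : Set ℝ} (hA : A.Nonempty) {a c X : ℝ} (ha : 0 ≤ a)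
    (h : ∀ s ∈ A, X ≤ a * s + c) : X ≤ a * sInf A + c := by
  rcases ha.eq_or_lt with rfl | hpos
  · obtain ⟨s, hs⟩ := hA
    simpa using h s hs
  · have : (X - c) / a ≤ sInf A := le_csInf hA fun s hs => by
      rw [div_le_iff₀ hpos]; linarith [h s hs]
    rw [div_le_iff₀ hpos] at this
    linarith

end Preconditioner

/-! ### Expectations along the iterates. -/

section Expectation

variable {Ω : Type*} [MeasurableSpace Ω] {μ : Measure Ω} {m n T : ℕ}
  {𝒳 : Set (Param m n)} {ℓ : Fin T → Ω → Param m n → ℝ}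
  {L : Param m n → ℝ} {S : Matrix (Fin m × Fin n) (Fin m × Fin n) ℝ}

theorem NoiseAssumption.convexOn (hnoise : NoiseAssumption μ 𝒳 ℓ L S) (hconv : Convex ℝ 𝒳)
    (hℓconv : ∀ t ω, ConvexOn ℝ Set.univ (ℓ t ω)) (t : Fin T) : ConvexOn ℝ 𝒳 L := by
  refine ⟨hconv, fun x hx y hy a b ha hb hab => ?_⟩
  rw [← hnoise.mean t _ (hconv hx hy ha hb hab), ← hnoise.mean t x hx, ← hnoise.mean t y hy,
    smul_eq_mul, smul_eq_mul, ← integral_const_mul, ← integral_const_mul,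
    ← integral_add ((hnoise.integrable t x hx).const_mul a)
      ((hnoise.integrable t y hy).const_mul b)]
  exact integral_mono (hnoise.integrable t _ (hconv hx hy ha hb hab))
    (((hnoise.integrable t x hx).const_mul a).add ((hnoise.integrable t y hy).const_mul b))
    fun ω => (hℓconv t ω).2 (Set.mem_univ x) (Set.mem_univ y) ha hb hab

theorem NoiseAssumption.sub_le_inner_gradient [IsProbabilityMeasure μ]
    (hnoise : NoiseAssumption μ 𝒳 ℓ L S)
    (hconv : Convex ℝ 𝒳) (hℓconv : ∀ t ω, ConvexOn ℝ Set.univ (ℓ t ω))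
    (hℓdiff : ∀ t ω, Differentiable ℝ (ℓ t ω)) (hL : Differentiable ℝ L) (t : Fin T)
    {x y : Param m n} (hx : x ∈ 𝒳) (hy : y ∈ 𝒳) :
    L x - L y ≤ inner ℝ (gradient L x) (x - y) := by
  have hG : Integrable (fun ω => gradient (ℓ t ω) x) μ :=
    (((hnoise.secondMoment t x hx).integrable (by norm_num)).add
      (integrable_const (gradient L x))).congr
      (Filter.Eventually.of_forall fun ω => sub_add_cancel _ _)
  have hfi : Integrable (fun ω => fderiv ℝ (ℓ t ω) x (y - x)) μ := by
    simp only [fderiv_eq_inner_gradient]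
    exact hG.inner_const _
  have h1 := integral_fderiv_eq (hℓconv t) (hℓdiff t) hconv hL (hnoise.integrable t)
    (hnoise.mean t) hx hy hfi
  have h2 : ∫ ω, fderiv ℝ (ℓ t ω) x (y - x) ∂μ ≤ ∫ ω, (ℓ t ω y - ℓ t ω x) ∂μ := by
    refine integral_mono hfi ((hnoise.integrable t y hy).sub (hnoise.integrable t x hx))
      fun ω => ?_
    have := fderiv_le_of_convexOn (hℓconv t ω) (hℓdiff t ω x) (y - x)
    rwa [add_sub_cancel] at this
  rw [h1, integral_sub (hnoise.integrable t y hy) (hnoise.integrable t x hx), hnoise.mean t y hy,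
    hnoise.mean t x hx, fderiv_eq_inner_gradient, ← neg_sub x y, inner_neg_right] at h2
  linarith

theorem quad_add_toMat {P : Matrix (Fin m) (Fin m) ℝ} (hP : P.IsHermitian) (x y : Param m n) :
    quad P (toMat (x + y)) = quad P (toMat x) + 2 * inner ℝ x (toVec (P * toMat y))
      + quad P (toMat y) := by
  have h := quad_sub_smul hP (toMat y) (toMat x) (-1)
  rw [neg_smul, one_smul, sub_neg_eq_add] at h
  rw [toMat_add, add_comm (toMat x), h, real_inner_comm, inner_eq_trace, toMat_toVec,
    Matrix.mul_assoc]
  ring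

/-- The expected squared dual norm of a stochastic gradient at an independent random point. -/
theorem NoiseAssumption.integral_quad_gradient_comp_le [IsProbabilityMeasure μ]
    (hnoise : NoiseAssumption μ 𝒳 ℓ L S)
    {t : Fin T} {X : Ω → Param m n}
    (hmean : ∀ x ∈ 𝒳, ∫ ω, (gradient (ℓ t ω) x - gradient L x) ∂μ = 0)
    (hbdd : Bornology.IsBounded 𝒳)
    (hLc : Continuous (gradient L)) (hd : ∀ ω, Differentiable ℝ (ℓ t ω))
    (hℓm : Measurable (ℓ t)) (hXm : Measurable X) (hX : ∀ ω, X ω ∈ 𝒳) (hi : IndepFun (ℓ t) X μ)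
    {P : Matrix (Fin m) (Fin m) ℝ} (hP : P.PosSemidef) :
    Integrable (fun ω => quad P (toMat (gradient (ℓ t ω) (X ω)))) μ ∧
    ∫ ω, quad P (toMat (gradient (ℓ t ω) (X ω))) ∂μ
      ≤ (S * (P ⊗ₖ (1 : Matrix (Fin n) (Fin n) ℝ))).trace
        + ∫ ω, quad P (toMat (gradient L (X ω))) ∂μ := by
  have hN := hnoise.memLp_noise_comp hLc hd hℓm hXm hX hi
  obtain ⟨C, hC⟩ := exists_norm_le_of_continuous hbdd hLc
  have hGL : MemLp (fun ω => gradient L (X ω)) 2 μ :=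
    memLp_of_bounded (hLc.measurable.comp hXm) fun ω => hC _ (hX ω)
  have hvc : Continuous fun x : Param m n => toVec (P * toMat (gradient L x)) := by
    refine (PiLp.continuous_toLp 2 _).comp (continuous_pi fun p => ?_)
    exact (continuous_const.matrix_mul (continuous_toMat.comp hLc)).matrix_elem p.1 p.2
  obtain ⟨C', hC'⟩ := exists_norm_le_of_continuous hbdd hvc
  have hv : MemLp (fun ω => toVec (P * toMat (gradient L (X ω)))) 2 μ :=
    memLp_of_bounded (hvc.measurable.comp hXm) fun ω => hC' _ (hX ω)
  -- Bias–variance expansion. The cross term pairs the noise with a function of X, so its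
  -- expectation is zero.
  have e : ∀ ω, quad P (toMat (gradient (ℓ t ω) (X ω)))
      = quad P (toMat (gradient (ℓ t ω) (X ω) - gradient L (X ω)))
        + 2 * inner ℝ (gradient (ℓ t ω) (X ω) - gradient L (X ω))
          (toVec (P * toMat (gradient L (X ω))))
        + quad P (toMat (gradient L (X ω))) := fun ω => by
    rw [← quad_add_toMat hP.1, sub_add_cancel]
  have i1 := integrable_quad_of_memLp P hN
  have i2 := (integrable_inner_of_memLp hN hv).const_mul 2
  have i3 := integrable_quad_of_memLp P hGL
  simp only [e]
  refine ⟨(i1.add i2).add i3, ?_⟩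
  have e1 := integral_add (i1.add i2) i3
  simp only [Pi.add_apply] at e1
  rw [e1, integral_add i1 i2, integral_const_mul,
    hnoise.integral_inner_noise_comp hmean hLc hd hℓm hXm hX hi hvc.measurable hC']
  have := hnoise.integral_quad_noise_comp_le hLc hd hℓm hXm hX hi hP
  linarith

/-- The expected suboptimality at an independent random point is at most the expected linearised
loss of the stochastic gradient. -/
theorem NoiseAssumption.integral_sub_le_integral_inner [IsProbabilityMeasure μ]
    (hnoise : NoiseAssumption μ 𝒳 ℓ L S)
    {t : Fin T} {X : Ω → Param m n}
    (hmean : ∀ x ∈ 𝒳, ∫ ω, (gradient (ℓ t ω) x - gradient L x) ∂μ = 0)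
    (hconv : Convex ℝ 𝒳) (hbdd : Bornology.IsBounded 𝒳)
    (hℓconv : ∀ t ω, ConvexOn ℝ Set.univ (ℓ t ω))
    (hℓdiff : ∀ t ω, Differentiable ℝ (ℓ t ω)) (hL : Differentiable ℝ L)
    (hLc : Continuous (gradient L))
    (hℓm : Measurable (ℓ t)) (hXm : Measurable X) (hX : ∀ ω, X ω ∈ 𝒳) (hi : IndepFun (ℓ t) X μ)
    {w : Param m n} (hw : w ∈ 𝒳) :
    Integrable (fun ω => inner ℝ (gradient (ℓ t ω) (X ω)) (X ω - w)) μ ∧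
    ∫ ω, (L (X ω) - L w) ∂μ ≤ ∫ ω, inner ℝ (gradient (ℓ t ω) (X ω)) (X ω - w) ∂μ := by
  have hN := hnoise.memLp_noise_comp hLc (hℓdiff t) hℓm hXm hX hi
  obtain ⟨C, hC⟩ := exists_norm_le_of_continuous hbdd hLc
  have hGL : MemLp (fun ω => gradient L (X ω)) 2 μ :=
    memLp_of_bounded (hLc.measurable.comp hXm) fun ω => hC _ (hX ω)
  have hvc : Continuous fun x : Param m n => x - w := by fun_prop
  obtain ⟨C', hC'⟩ := exists_norm_le_of_continuous hbdd hvc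
  have hv : MemLp (fun ω => X ω - w) 2 μ :=
    memLp_of_bounded (hvc.measurable.comp hXm) fun ω => hC' _ (hX ω)
  have e : ∀ ω, inner ℝ (gradient (ℓ t ω) (X ω)) (X ω - w)
      = inner ℝ (gradient (ℓ t ω) (X ω) - gradient L (X ω)) (X ω - w)
        + inner ℝ (gradient L (X ω)) (X ω - w) := fun ω => by
    rw [← inner_add_left, sub_add_cancel]
  have i1 := integrable_inner_of_memLp hN hv
  have i2 := integrable_inner_of_memLp hGL hv
  simp only [e]
  refine ⟨i1.add i2, ?_⟩
  rw [integral_add i1 i2,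
    hnoise.integral_inner_noise_comp hmean hLc (hℓdiff t) hℓm hXm hX hi hvc.measurable hC',
    zero_add]
  obtain ⟨C'', hC''⟩ := exists_norm_le_of_continuous hbdd (hL.continuous.sub continuous_const)
  refine integral_mono (Integrable.of_bound
    ((hL.continuous.measurable.comp hXm).sub_const (L w)).aestronglyMeasurable C''
    (Filter.Eventually.of_forall fun ω => hC'' _ (hX ω))) i2 fun ω => ?_
  exact hnoise.sub_le_inner_gradient hconv hℓconv hℓdiff hL t (hX ω) hw

end Expectation

/-! ### Optimising the weights. -/

section Rate

/-- Here B is the total expected gap, h the trace of the smoothness matrix, a that of the noise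
preconditioner and s its noise value. -/
theorem rate_of_forall_weights {R n m T ε s B h a : ℝ} (hR : 0 ≤ R) (hn : 0 < n) (hm : 0 ≤ m)
    (hT : 0 ≤ T) (hε : 0 ≤ ε) (hs : 0 ≤ s) (ha : a ≤ 1 / n)
    (hyp : ∀ p₁ p₂ p₃ : ℝ, 0 < p₁ → 0 < p₂ → 0 < p₃ →
      B ≤ Real.sqrt 2 * Real.sqrt n * R * (ε * (m / p₁) + 1 / n * (T * (s ^ 2 / p₃) + 2 / p₂ * B)
        + (p₁ * m + p₂ * h + p₃ * a))) :
    B ≤ 16 * R ^ 2 * h + 4 * Real.sqrt 2 * R * (Real.sqrt T / Real.sqrt n) * s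
      + 4 * Real.sqrt 2 * Real.sqrt n * R * m * Real.sqrt ε := by
  rcases hR.eq_or_lt with rfl | hpos
  · simpa using hyp 1 1 1 one_pos one_pos one_pos
  have h2 : 0 < Real.sqrt 2 := Real.sqrt_pos.mpr two_pos
  have h22 : Real.sqrt 2 ^ 2 = 2 := Real.sq_sqrt two_pos.le
  have hsn : 0 < Real.sqrt n := Real.sqrt_pos.mpr hn
  have hsnn : Real.sqrt n ^ 2 = n := Real.sq_sqrt hn.le
  refine le_of_forall_pos_le_add_mul
    -- The optimal p₁ = √ε and p₃ = √T s may vanish, so both are shifted by δ; this c collects the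
    -- resulting excess, doubled by the absorption of B.
    (c := 2 * (Real.sqrt 2 * Real.sqrt n * R * m + Real.sqrt 2 * R / Real.sqrt n)) fun δ hδ => ?_
  have hp₁ : 0 < Real.sqrt ε + δ := by positivity
  have hp₃ : 0 < Real.sqrt T * s + δ := by positivity
  have hp₂ : 0 < 4 * Real.sqrt 2 * R / Real.sqrt n := by positivity
  have H := hyp _ _ _ hp₁ hp₂ hp₃
  have b1 : ε * (m / (Real.sqrt ε + δ)) ≤ Real.sqrt ε * m := by
    rw [mul_div_assoc', div_le_iff₀ hp₁]
    have e : ε = Real.sqrt ε * Real.sqrt ε := (Real.mul_self_sqrt hε).symm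
    have : 0 ≤ Real.sqrt ε * m * δ := by positivity
    nlinarith
  have b3 : T * (s ^ 2 / (Real.sqrt T * s + δ)) ≤ Real.sqrt T * s := by
    rw [mul_div_assoc', div_le_iff₀ hp₃]
    have e : T * s ^ 2 = (Real.sqrt T * s) * (Real.sqrt T * s) := by
      rw [mul_mul_mul_comm, Real.mul_self_sqrt hT]; ring
    have : 0 ≤ Real.sqrt T * s * δ := by positivity
    rw [e]
    nlinarith
  have b4 : (Real.sqrt T * s + δ) * a ≤ (Real.sqrt T * s + δ) * (1 / n) :=
    mul_le_mul_of_nonneg_left ha hp₃.le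
  have b3' : 1 / n * (T * (s ^ 2 / (Real.sqrt T * s + δ))) ≤ 1 / n * (Real.sqrt T * s) :=
    mul_le_mul_of_nonneg_left b3 (by positivity)
  have H2 : B ≤ Real.sqrt 2 * Real.sqrt n * R * ((2 * Real.sqrt ε + δ) * m
      + (2 * (Real.sqrt T * s) + δ) * (1 / n)
      + (1 / n * (2 / (4 * Real.sqrt 2 * R / Real.sqrt n) * B)
        + 4 * Real.sqrt 2 * R / Real.sqrt n * h)) := by
    refine H.trans (mul_le_mul_of_nonneg_left ?_ (by positivity))
    rw [mul_add (1 / n)]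
    linarith
  have c1 : Real.sqrt 2 * Real.sqrt n * R * (1 / n) = Real.sqrt 2 * R / Real.sqrt n := by
    rw [eq_div_iff hsn.ne']
    calc _ = Real.sqrt 2 * R * (Real.sqrt n ^ 2 * (1 / n)) := by ring
      _ = _ := by rw [hsnn, mul_one_div_cancel hn.ne', mul_one]
  have c2 : Real.sqrt 2 * Real.sqrt n * R * (4 * Real.sqrt 2 * R / Real.sqrt n) = 8 * R ^ 2 := by
    calc _ = 4 * Real.sqrt 2 ^ 2 * R ^ 2 * (Real.sqrt n / Real.sqrt n) := by ring
      _ = _ := by rw [h22, div_self hsn.ne']; ring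
  -- The purpose of p₂: B returns with coefficient 1/2 and can be moved to the left.
  have c3 : Real.sqrt 2 * Real.sqrt n * R * (1 / n * (2 / (4 * Real.sqrt 2 * R / Real.sqrt n)))
      = 1 / 2 := by
    rw [← mul_assoc, c1]
    field_simp
    norm_num
  have e : Real.sqrt 2 * Real.sqrt n * R * ((2 * Real.sqrt ε + δ) * m
      + (2 * (Real.sqrt T * s) + δ) * (1 / n)
      + (1 / n * (2 / (4 * Real.sqrt 2 * R / Real.sqrt n) * B)
        + 4 * Real.sqrt 2 * R / Real.sqrt n * h))
      = Real.sqrt 2 * Real.sqrt n * R * ((2 * Real.sqrt ε + δ) * m)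
        + (Real.sqrt 2 * Real.sqrt n * R * (1 / n)) * (2 * (Real.sqrt T * s) + δ)
        + (Real.sqrt 2 * Real.sqrt n * R
            * (1 / n * (2 / (4 * Real.sqrt 2 * R / Real.sqrt n)))) * B
        + (Real.sqrt 2 * Real.sqrt n * R * (4 * Real.sqrt 2 * R / Real.sqrt n)) * h := by
    ring
  rw [e, c1, c2, c3] at H2
  have f1 : 4 * Real.sqrt 2 * R * (Real.sqrt T / Real.sqrt n) * s
      = 2 * (Real.sqrt 2 * R / Real.sqrt n * (2 * (Real.sqrt T * s))) := by ring
  rw [f1]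
  linarith

end Rate

/-! ### The bound on the total expected suboptimality. -/

section Main

variable {Ω : Type*} [MeasurableSpace Ω] {μ : Measure Ω} {m n T : ℕ}
  {𝒳 : Set (Param m n)} {ℓ : Fin T → Ω → Param m n → ℝ}
  {L : Param m n → ℝ} {S : Matrix (Fin m × Fin n) (Fin m × Fin n) ℝ}

/-- The expected total suboptimality, in variational form. -/
theorem sum_integral_sub_le [IsProbabilityMeasure μ] (hn : 0 < n) (hT : 0 < T)
    (hconv : Convex ℝ 𝒳) (hbdd : Bornology.IsBounded 𝒳) (hℓmeas : ∀ t, Measurable (ℓ t))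
    (hℓindep : iIndepFun ℓ μ) (hℓconv : ∀ t ω, ConvexOn ℝ Set.univ (ℓ t ω))
    (hℓdiff : ∀ t ω, Differentiable ℝ (ℓ t ω)) (hL : Differentiable ℝ L)
    (hLc : Continuous (gradient L)) (hnoise : NoiseAssumption μ 𝒳 ℓ L S)
    (hgrad : interior 𝒳 = ∅ → ∀ t, ∀ x ∈ 𝒳, ∫ ω, gradient (ℓ t ω) x ∂μ = gradient L x)
    {w : Param m n} (hw : w ∈ 𝒳) {ε : ℝ} (hε : 0 ≤ ε) {x₁ : Param m n} (hx₁ : x₁ ∈ 𝒳)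
    {x : Fin T → Ω → Param m n}
    (hx : ∀ ω, IsOneSidedShampoo (Real.sqrt (2 / n) * setOpNorm 𝒳) ε 𝒳 x₁
      (fun t => ℓ t ω) (fun t => x t ω)) (hxm : ∀ t, Measurable (x t))
    {P : Matrix (Fin m) (Fin m) ℝ} (hP : P.PosDef) :
    ∑ t, ∫ ω, (L (x t ω) - L w) ∂μ
      ≤ Real.sqrt 2 * Real.sqrt n * setOpNorm 𝒳 * (ε * P⁻¹.trace
        + 1 / n * ∑ t, ((S * (P⁻¹ ⊗ₖ (1 : Matrix (Fin n) (Fin n) ℝ))).trace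
          + ∫ ω, quad P⁻¹ (toMat (gradient L (x t ω))) ∂μ) + P.trace) := by
  have hmem : ∀ t ω, x t ω ∈ 𝒳 := fun t ω => (hx ω).mem hx₁ t
  have hind := indepFun_iterate hconv hbdd hℓmeas hℓindep hℓdiff hx
  have hmean : ∀ t, ∀ y ∈ 𝒳, ∫ ω, (gradient (ℓ t ω) y - gradient L y) ∂μ = 0 := fun t y hy =>
    hnoise.integral_noise_eq_zero hconv hℓconv hℓdiff hL hgrad t hy
  have hlin := fun t => hnoise.integral_sub_le_integral_inner (hmean t) hconv hbdd hℓconv hℓdiff hL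
    hLc (hℓmeas t) (hxm t) (hmem t) (hind t) hw
  have hquad := fun t => hnoise.integral_quad_gradient_comp_le (hmean t) hbdd hLc (hℓdiff t)
    (hℓmeas t) (hxm t) (hmem t) (hind t) hP.inv.posSemidef
  have hk : 0 ≤ Real.sqrt 2 * Real.sqrt n * setOpNorm 𝒳 :=
    mul_nonneg (by positivity) (setOpNorm_nonneg hbdd hw)
  have hsum : Integrable (fun ω => 1 / (n : ℝ)
      * ∑ t, quad P⁻¹ (toMat (gradient (ℓ t ω) (x t ω)))) μ :=
    (integrable_finsetSum _ fun t _ => (hquad t).1).const_mul _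
  have hA : Integrable (fun ω => ε * P⁻¹.trace
      + 1 / (n : ℝ) * ∑ t, quad P⁻¹ (toMat (gradient (ℓ t ω) (x t ω)))) μ :=
    (integrable_const _).add hsum
  calc ∑ t, ∫ ω, (L (x t ω) - L w) ∂μ
      ≤ ∑ t, ∫ ω, inner ℝ (gradient (ℓ t ω) (x t ω)) (x t ω - w) ∂μ :=
        Finset.sum_le_sum fun t _ => (hlin t).2
    _ = ∫ ω, ∑ t, inner ℝ (gradient (ℓ t ω) (x t ω)) (x t ω - w) ∂μ :=
        (integral_finsetSum _ fun t _ => (hlin t).1).symm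
    _ ≤ ∫ ω, Real.sqrt 2 * Real.sqrt n * setOpNorm 𝒳 * (ε * P⁻¹.trace
        + 1 / n * ∑ t, quad P⁻¹ (toMat (gradient (ℓ t ω) (x t ω))) + P.trace) ∂μ :=
        integral_mono (integrable_finsetSum _ fun t _ => (hlin t).1)
          ((hA.add (integrable_const _)).const_mul _) fun ω =>
          (hx ω).regret_le_variational hx₁ hconv hbdd hn hT hε hw hP
    _ = Real.sqrt 2 * Real.sqrt n * setOpNorm 𝒳 * (ε * P⁻¹.trace
        + 1 / n * ∑ t, ∫ ω, quad P⁻¹ (toMat (gradient (ℓ t ω) (x t ω))) ∂μ + P.trace) := by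
        have e := integral_finsetSum Finset.univ fun t (_ : t ∈ Finset.univ) => (hquad t).1
        rw [integral_const_mul, integral_add hA (integrable_const _),
          integral_add (integrable_const _) hsum, integral_const_mul (1 / (n : ℝ)), e]
        simp
    _ ≤ _ := by
        refine mul_le_mul_of_nonneg_left ?_ hk
        gcongr with t
        exact (hquad t).2

theorem trace_inv_le_div {P : Matrix (Fin m) (Fin m) ℝ} {p : ℝ} (hp : 0 < p)
    (h : (P - p • (1 : Matrix (Fin m) (Fin m) ℝ)).PosSemidef) : P⁻¹.trace ≤ m / p := by
  have h1 := (posSemidef_inv_sub_inv (Matrix.PosDef.one.smul hp) h).trace_nonneg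
  rw [inv_smul_posDef Matrix.PosDef.one hp, inv_one, Matrix.trace_sub, Matrix.trace_smul,
    Matrix.trace_one, Fintype.card_fin, smul_eq_mul] at h1
  rw [div_eq_inv_mul]
  linarith

/-- The bound on the expected total suboptimality for given smoothness and noise
preconditioners. -/
theorem sum_integral_sub_le_rate [IsProbabilityMeasure μ] (hn : 0 < n) (hT : 0 < T)
    (hconv : Convex ℝ 𝒳) (hbdd : Bornology.IsBounded 𝒳) (hℓmeas : ∀ t, Measurable (ℓ t))
    (hℓindep : iIndepFun ℓ μ) (hℓconv : ∀ t ω, ConvexOn ℝ Set.univ (ℓ t ω))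
    (hℓdiff : ∀ t ω, Differentiable ℝ (ℓ t ω)) (hL : Differentiable ℝ L)
    (hL2 : Differentiable ℝ (fderiv ℝ L)) (hnoise : NoiseAssumption μ 𝒳 ℓ L S)
    (hgrad : interior 𝒳 = ∅ → ∀ t, ∀ x ∈ 𝒳, ∫ ω, gradient (ℓ t ω) x ∂μ = gradient L x)
    {w : Param m n} (hw : w ∈ 𝒳) (hmin : ∀ y, L w ≤ L y)
    {ε : ℝ} (hε : 0 ≤ ε) {x₁ : Param m n} (hx₁ : x₁ ∈ 𝒳) {x : Fin T → Ω → Param m n}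
    (hx : ∀ ω, IsOneSidedShampoo (Real.sqrt (2 / n) * setOpNorm 𝒳) ε 𝒳 x₁
      (fun t => ℓ t ω) (fun t => x t ω)) (hxm : ∀ t, Measurable (x t))
    {H : Matrix (Fin m) (Fin m) ℝ} (hH : H.PosDef)
    (hbound : ∀ X Δ : Param m n, fderiv ℝ (fderiv ℝ L) X Δ Δ ≤ quad H (toMat Δ))
    {A : Matrix (Fin m) (Fin m) ℝ} (hA : A.PosDef) (hAtr : n * A.trace ≤ 1) {s : ℝ} (hs : 0 ≤ s)
    (hAs : (S * (A⁻¹ ⊗ₖ (1 : Matrix (Fin n) (Fin n) ℝ))).trace = s ^ 2) :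
    ∑ t, ∫ ω, (L (x t ω) - L w) ∂μ
      ≤ 16 * setOpNorm 𝒳 ^ 2 * H.trace
        + 4 * Real.sqrt 2 * setOpNorm 𝒳 * (Real.sqrt T / Real.sqrt n) * s
        + 4 * Real.sqrt 2 * Real.sqrt n * setOpNorm 𝒳 * m * Real.sqrt ε := by
  have hn' : (0 : ℝ) < n := by exact_mod_cast hn
  have hLc : Continuous (gradient L) := continuous_gradient hL2.continuous
  have hmem : ∀ t ω, x t ω ∈ 𝒳 := fun t ω => (hx ω).mem hx₁ t
  have hk : 0 ≤ Real.sqrt 2 * Real.sqrt n * setOpNorm 𝒳 :=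
    mul_nonneg (by positivity) (setOpNorm_nonneg hbdd hw)
  obtain ⟨C, hC⟩ := exists_norm_le_of_continuous hbdd (hL.continuous.sub continuous_const)
  have hgap : ∀ t, Integrable (fun ω => L (x t ω) - L w) μ := fun t => Integrable.of_bound
    ((hL.continuous.measurable.comp (hxm t)).sub_const (L w)).aestronglyMeasurable C
    (Filter.Eventually.of_forall fun ω => hC _ (hmem t ω))
  refine rate_of_forall_weights (setOpNorm_nonneg hbdd hw) hn' m.cast_nonneg T.cast_nonneg hε hs
    (a := A.trace) ?_ fun p₁ p₂ p₃ hp₁ hp₂ hp₃ => ?_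
  · rw [le_div_iff₀ hn']; linarith
  -- P dominates each summand, so P⁻¹ may be replaced by (p₁ I)⁻¹ in the ε term, by (p₂ H)⁻¹ in the
  -- gradient term and by (p₃ A)⁻¹ in the noise term.
  set P : Matrix (Fin m) (Fin m) ℝ := p₁ • 1 + p₂ • H + p₃ • A with hPdef
  have d₁ : (p₁ • (1 : Matrix (Fin m) (Fin m) ℝ)).PosDef := Matrix.PosDef.one.smul hp₁
  have d₂ : (p₂ • H).PosDef := hH.smul hp₂
  have d₃ : (p₃ • A).PosDef := hA.smul hp₃
  have hP : P.PosDef := (d₁.add d₂).add d₃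
  have s₁ : (P - p₁ • 1).PosSemidef := by
    rw [show P - p₁ • 1 = p₂ • H + p₃ • A by rw [hPdef]; abel]
    exact (d₂.add d₃).posSemidef
  have s₂ : (P - p₂ • H).PosSemidef := by
    rw [show P - p₂ • H = p₁ • 1 + p₃ • A by rw [hPdef]; abel]
    exact (d₁.add d₃).posSemidef
  have s₃ : (P - p₃ • A).PosSemidef := by
    rw [show P - p₃ • A = p₁ • 1 + p₂ • H by rw [hPdef]; abel]
    exact (d₁.add d₂).posSemidef
  have b₁ := trace_inv_le_div hp₁ s₁
  have b₂ : ∀ t, ∫ ω, quad P⁻¹ (toMat (gradient L (x t ω))) ∂μ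
      ≤ 2 / p₂ * ∫ ω, (L (x t ω) - L w) ∂μ := by
    intro t
    rw [← integral_const_mul]
    refine integral_mono_of_nonneg
      (Filter.Eventually.of_forall fun ω => quad_nonneg hP.inv.posSemidef _)
      ((hgap t).const_mul _) (Filter.Eventually.of_forall fun ω => ?_)
    have h1 := quad_mono (posSemidef_inv_sub_inv d₂ s₂) (toMat (gradient L (x t ω)))
    rw [inv_smul_posDef hH hp₂, quad_smul_left] at h1
    have h2 := quad_inv_gradient_le hL hL2 hH hbound hmin (x t ω)
    have h3 := mul_le_mul_of_nonneg_left h2 (inv_nonneg.mpr hp₂.le)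
    refine h1.trans (h3.trans (le_of_eq ?_))
    ring
  have b₃ : (S * (P⁻¹ ⊗ₖ (1 : Matrix (Fin n) (Fin n) ℝ))).trace ≤ s ^ 2 / p₃ := by
    refine (trace_mul_kronecker_one_mono hnoise.posSemidef (posSemidef_inv_sub_inv d₃ s₃)).trans
      (le_of_eq ?_)
    rw [inv_smul_posDef hA hp₃, Matrix.smul_kronecker, Matrix.mul_smul, Matrix.trace_smul, hAs,
      smul_eq_mul, div_eq_inv_mul]
  refine (sum_integral_sub_le hn hT hconv hbdd hℓmeas hℓindep hℓconv hℓdiff hL hLc hnoise hgrad hw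
    hε hx₁ hx hxm hP).trans (mul_le_mul_of_nonneg_left ?_ hk)
  have e₁ : ∑ t, ((S * (P⁻¹ ⊗ₖ (1 : Matrix (Fin n) (Fin n) ℝ))).trace
      + ∫ ω, quad P⁻¹ (toMat (gradient L (x t ω))) ∂μ)
      ≤ T * (s ^ 2 / p₃) + 2 / p₂ * ∑ t, ∫ ω, (L (x t ω) - L w) ∂μ := by
    rw [Finset.sum_add_distrib, Finset.mul_sum]
    refine add_le_add ?_ (Finset.sum_le_sum fun t _ => b₂ t)
    simp only [Finset.sum_const, Finset.card_univ, Fintype.card_fin, nsmul_eq_mul]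
    exact mul_le_mul_of_nonneg_left b₃ T.cast_nonneg
  have e₂ : P.trace = p₁ * m + p₂ * H.trace + p₃ * A.trace := by
    simp [hPdef]
  rw [e₂]
  gcongr

end Main

end Shampoo

/-! ### Averaging, infima and the final constants. -/

theorem mainTheorem6 {Ω : Type*} [MeasurableSpace Ω] (μ : Measure Ω) [IsProbabilityMeasure μ]
    (dL dR T : ℕ) (hdL : 0 < dL) (hdR : 0 < dR) (hT : 0 < T)
    (𝒳 : Set (Shampoo.Param dL dR)) (h𝒳conv : Convex ℝ 𝒳) (h𝒳bdd : Bornology.IsBounded 𝒳)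
    -- the independent stochastic convex losses, random elements of the space of functions
    (ℓ : Fin T → Ω → Shampoo.Param dL dR → ℝ)
    (hℓmeas : ∀ t, Measurable (ℓ t))
    (hℓindep : iIndepFun ℓ μ)
    (hℓconv : ∀ t ω, ConvexOn ℝ Set.univ (ℓ t ω))
    (hℓdiff : ∀ t ω, Differentiable ℝ (ℓ t ω))
    -- the expected loss, twice differentiable, with finite left smoothness
    (L : Shampoo.Param dL dR → ℝ)
    (hLdiff : Differentiable ℝ L) (hLdiff2 : Differentiable ℝ (fderiv ℝ L))
    (hLsmooth : (Shampoo.leftSmoothnessSet L).Nonempty)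
    (S : Matrix (Fin dL × Fin dR) (Fin dL × Fin dR) ℝ)
    (hnoise : Shampoo.NoiseAssumption μ 𝒳 ℓ L S)
    -- if `𝒳` has no interior, the expectations on `𝒳` do not determine those of the gradients
    (hgrad : interior 𝒳 = ∅ → ∀ t, ∀ x ∈ 𝒳, ∫ ω, gradient (ℓ t ω) x ∂μ = gradient L x)
    -- a global minimizer in the domain
    (xstar : Shampoo.Param dL dR) (hxstar : xstar ∈ 𝒳) (hmin : ∀ y, L xstar ≤ L y)
    -- the iterates
    (ε : ℝ) (hε : 0 ≤ ε)
    (x₁ : Shampoo.Param dL dR) (hx₁ : x₁ ∈ 𝒳)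
    (x : Fin T → Ω → Shampoo.Param dL dR)
    (hx : ∀ ω, Shampoo.IsOneSidedShampoo (Real.sqrt (2 / dR) * Shampoo.setOpNorm 𝒳) ε 𝒳 x₁
      (fun t => ℓ t ω) (fun t => x t ω)) :
    Integrable (fun ω => L ((1 / (T : ℝ)) • ∑ t, x t ω) - L xstar) μ ∧
    ∫ ω, (L ((1 / (T : ℝ)) • ∑ t, x t ω) - L xstar) ∂μ ≤
      16 / (T * dR) * Shampoo.setOpNorm 𝒳 ^ 2 * Shampoo.leftSmoothness L
        + 4 * Real.sqrt 2 / Real.sqrt (T * dR) * Shampoo.setOpNorm 𝒳 * Shampoo.noiseLevel S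
        + 4 * Real.sqrt 2 * ((dL * dR : ℕ) : ℝ) * Real.sqrt ε / T * Shampoo.setOpNorm 𝒳 := by
  open Shampoo in
  have hn : (0 : ℝ) < dR := by exact_mod_cast hdR
  have hn1 : (1 : ℝ) ≤ dR := by exact_mod_cast hdR
  have hT' : (0 : ℝ) < T := by exact_mod_cast hT
  set R := setOpNorm 𝒳 with hRdef
  have hR : 0 ≤ R := setOpNorm_nonneg h𝒳bdd hxstar
  have hxm : ∀ t, Measurable (x t) := fun t =>
    measurable_iterate h𝒳conv h𝒳bdd hℓdiff hx T (fun s _ => hℓmeas s) t t.isLt.le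
  have hmem : ∀ t ω, x t ω ∈ 𝒳 := fun t ω => (hx ω).mem hx₁ t
  have hsum1 : ∑ _t : Fin T, (1 / (T : ℝ)) = 1 := by
    simp [hT'.ne']
  have hbar : ∀ ω, (1 / (T : ℝ)) • ∑ t, x t ω ∈ 𝒳 := fun ω => by
    rw [Finset.smul_sum]
    exact h𝒳conv.sum_mem (fun _ _ => by positivity) hsum1 fun t _ => hmem t ω
  have hbarm : Measurable fun ω => (1 / (T : ℝ)) • ∑ t, x t ω :=
    Measurable.const_smul (g := fun ω => ∑ t, x t ω) (Finset.measurable_sum _ fun t _ => hxm t)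
      (1 / (T : ℝ))
  obtain ⟨C, hC⟩ := exists_norm_le_of_continuous h𝒳bdd
    (hLdiff.continuous.sub (continuous_const (y := L xstar)))
  have hint : ∀ {X : Ω → Param dL dR}, Measurable X → (∀ ω, X ω ∈ 𝒳) →
      Integrable (fun ω => L (X ω) - L xstar) μ := fun hXm hX => Integrable.of_bound
    ((hLdiff.continuous.measurable.comp hXm).sub_const (L xstar)).aestronglyMeasurable C
    (Filter.Eventually.of_forall fun ω => hC _ (hX ω))
  refine ⟨hint hbarm hbar, ?_⟩
  have hjensen : ∫ ω, (L ((1 / (T : ℝ)) • ∑ t, x t ω) - L xstar) ∂μ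
      ≤ 1 / T * ∑ t, ∫ ω, (L (x t ω) - L xstar) ∂μ := by
    rw [← integral_finsetSum _ fun t _ => hint (hxm t) (hmem t), ← integral_const_mul]
    refine integral_mono (hint hbarm hbar)
      ((integrable_finsetSum _ fun t _ => hint (hxm t) (hmem t)).const_mul _) fun ω => ?_
    have h1 := (hnoise.convexOn h𝒳conv hℓconv ⟨0, hT⟩).map_sum_le (t := Finset.univ)
      (w := fun _ : Fin T => 1 / (T : ℝ)) (p := fun t => x t ω)
      (fun _ _ => by positivity) hsum1 fun t _ => hmem t ω
    simp only [smul_eq_mul] at h1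
    rw [← Finset.smul_sum, ← Finset.mul_sum] at h1
    change L ((1 / (T : ℝ)) • ∑ t, x t ω) - L xstar ≤ 1 / T * ∑ t, (L (x t ω) - L xstar)
    have h2 : 1 / (T : ℝ) * ∑ t, (L (x t ω) - L xstar)
        = 1 / (T : ℝ) * ∑ t, L (x t ω) - L xstar := by
      rw [Finset.sum_sub_distrib, mul_sub]
      simp [hT'.ne']
    rw [h2]
    linarith
  refine hjensen.trans ?_
  set B := ∑ t, ∫ ω, (L (x t ω) - L xstar) ∂μ
  -- The bound is affine in h and in s with nonnegative slopes, so it passes to both infima without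
  -- their being attained.
  have hrate : ∀ h ∈ leftSmoothnessSet L, ∀ s ∈ {s | ∃ H ∈ preconditioners dL dR, H.PosDef ∧
      H.trace ≤ 1 ∧ s = Real.sqrt ((Sᵀ * H⁻¹).trace)},
      B ≤ 16 * R ^ 2 / dR * h + (4 * Real.sqrt 2 * R * (Real.sqrt T / Real.sqrt dR) * s
        + 4 * Real.sqrt 2 * Real.sqrt dR * R * dL * Real.sqrt ε) := by
    intro h hh s hs
    obtain ⟨A, hA, hAtr, hs0, hAs⟩ := exists_posDef_of_mem_noiseLevelSet hdR hnoise.posSemidef hs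
    -- The smoothness matrix made positive definite by δ I has trace h / dR + δ dL.
    refine le_of_forall_pos_le_add_mul (c := 16 * R ^ 2 * dL) fun δ hδ => ?_
    obtain ⟨H, hH, hHtr, hbound⟩ := exists_posDef_of_mem_leftSmoothnessSet hdR hh hδ
    have hb := sum_integral_sub_le_rate hdR hT h𝒳conv h𝒳bdd hℓmeas hℓindep hℓconv hℓdiff hLdiff
      hLdiff2 hnoise hgrad hxstar hmin hε hx₁ hx hxm hH hbound hA hAtr hs0 hAs
    have hHtr' : H.trace = h / dR + δ * dL := by
      field_simp
      linarith
    rw [hHtr', ← hRdef] at hb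
    refine hb.trans (le_of_eq ?_)
    ring
  have hB : B ≤ 16 * R ^ 2 / dR * leftSmoothness L
      + (4 * Real.sqrt 2 * R * (Real.sqrt T / Real.sqrt dR) * noiseLevel S
        + 4 * Real.sqrt 2 * Real.sqrt dR * R * dL * Real.sqrt ε) := by
    refine le_mul_sInf_add hLsmooth (by positivity) fun h hh => ?_
    have := le_mul_sInf_add (noiseLevelSet_nonempty hdL hdR S) (X := B)
      (a := 4 * Real.sqrt 2 * R * (Real.sqrt T / Real.sqrt dR))
      (c := 16 * R ^ 2 / dR * h + 4 * Real.sqrt 2 * Real.sqrt dR * R * dL * Real.sqrt ε)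
      (by positivity) fun s hs => by linarith [hrate h hh s hs]
    change B ≤ _ * noiseLevel S + _ at this
    linarith
  have hmul := mul_le_mul_of_nonneg_left hB (by positivity : (0 : ℝ) ≤ 1 / T)
  refine hmul.trans ?_
  have hsT : 0 < Real.sqrt T := Real.sqrt_pos.mpr hT'
  have hsn : 0 < Real.sqrt dR := Real.sqrt_pos.mpr hn
  have t2 : 1 / (T : ℝ) * (4 * Real.sqrt 2 * R * (Real.sqrt T / Real.sqrt dR) * noiseLevel S)
      = 4 * Real.sqrt 2 / Real.sqrt (T * dR) * R * noiseLevel S := by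
    rw [Real.sqrt_mul hT'.le]
    have : 1 / (T : ℝ) * Real.sqrt T = 1 / Real.sqrt T := by
      rw [one_div_mul_eq_div, Real.sqrt_div_self']
    calc _ = (1 / (T : ℝ) * Real.sqrt T) * (4 * Real.sqrt 2 * R / Real.sqrt dR * noiseLevel S) := by
          ring
      _ = _ := by rw [this]; field_simp
  have t3 : 1 / (T : ℝ) * (4 * Real.sqrt 2 * Real.sqrt dR * R * dL * Real.sqrt ε)
      ≤ 4 * Real.sqrt 2 * ((dL * dR : ℕ) : ℝ) * Real.sqrt ε / T * R := by
    -- The argument gives dL √dR in the ε term; the stated d = dL dR is weaker.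
    have hle : Real.sqrt dR ≤ dR := Real.sqrt_le_iff.mpr ⟨hn.le, by nlinarith⟩
    have h4 := mul_le_mul_of_nonneg_left hle
      (by positivity : 0 ≤ 1 / (T : ℝ) * (4 * Real.sqrt 2 * R * dL * Real.sqrt ε))
    push_cast
    calc _ = 1 / (T : ℝ) * (4 * Real.sqrt 2 * R * dL * Real.sqrt ε) * Real.sqrt dR := by ring
      _ ≤ _ := h4
      _ = _ := by ring
  rw [mul_add, mul_add, t2]
  have t1 : 1 / (T : ℝ) * (16 * R ^ 2 / dR * leftSmoothness L)
      = 16 / (T * dR) * R ^ 2 * leftSmoothness L := by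
    field_simp
  rw [t1]
  linarith
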